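/- Let $(W,S)_B$ be a geometric Coxeter system of finite rank $n=|S|$: a Coxeter system with orders $m_{st}$, together with the matrix $B_{st}=-\cos(\pi/m_{st})$ if $m_{st}<\infty$ and $B_{st}=-c_{st}$ with some $c_{st}=c_{ts}\ge 1$ if $m_{st}=\infty$. Let $\mathcal B$ be the bilinear form on $V=\mathbb R^S$ with $\mathcal B(\alpha_s,\alpha_t)=B_{st}$ on the standard basis $(\alpha_s)$, on which $W$ acts by $s(x)=x-2\mathcal B(x,\alpha_s)\alpha_s$. Assume that - the system is irreducible (the Coxeter graph is connected); - it is Lorentzian ($\mathcal B$ has signature $(n-1,1)$); - it is of level $2$: every principal submatrix of $B$ on $n-2$ indices is positive semidefinite, but not every one on $n-1$ indices is. Let $Q=\{x:\mathcal B(x,x)=0\}$, let $(\omega_s)$ be the basis of $V$ with $\mathcal B(\alpha_s,\omega_t)=\delta_{st}$, let $\Omega=\{w(\omega_s)\}$ be the set of weights, and let $T$ (the Tits cone) be the closed convex cone spanned by $\Omega$. For $X\subseteq V$ write $\widehat X$ for the set of points of $\mathbb PV$ spanned by nonzero elements of $X$. Call a light-like vector future-directed if $h(x)>0$, where $h(x)=\sum_s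 c_sx_s$ is a sum of the coordinates with positive weights $c_s$ for which $\{h=0\}\cap Q=\{0\}$. The ball of a space-like weight $\omega$ (that is, $\mathcal B(\omega,\omega)>0$) is the set of points of $\widehat Q$ spanned by future-directed $x\in Q$ with $\mathcal B(\omega,x)\le 0$; the Boyd–Maxwell packing $\mathscr P$ is the set of the balls of all space-like weights, and its tangency graph has the balls as vertices, two distinct balls being adjacent if they meet in exactly one point. A vertex of $\widehat T$ is a point of $\widehat T$ at which the normal cone has full dimension, i.e. such that the supporting hyperplanes of $T$ through it have no other point of $\mathbb PV$ in common. An edge of $\widehat T$ is a one-dimensional face (a two-dimensional face of the cone $T$). The $1$-skeleton of $\widehat T$ is the graph on the vertices of $\widehat T$ in which two distinct vertices are adjacent if they lie on a common edge. Then $\widehat T$ is an edge-tangent infinite polytope whose $1$-skeleton is the tangency graph of $\mathscr P$: 1. $\widehat T$ has infinitely many vertices, and $T$ is the closed convex cone spanned by the vertices. 2. Every edge of $\widehat T$ is tangent to $\widehat Q$: the projective line spanned by the edge meets $\widehat Q$ in exactly one point, and this point lies on the edge. 3. There is an isomorphism from the tangency graph of $\mathscr P$ onto the $1$-skeleton of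 $\widehat T$ that sends the ball of each space-like weight $\omega$ to the point of $\mathbb PV$ spanned by $\omega$. -/

import Mathlib

open scoped LinearAlgebra.Projectivization Matrix

noncomputable section

/-! ### Convex cones seen in projective space -/

section ProjectiveCones

variable {E : Type*} [AddCommGroup E] [Module ℝ E]

/-- The projective set of lines spanned by the nonzero vectors of `X`. -/
def projSet (X : Set E) : Set (ℙ ℝ E) :=
  {p | ∃ x ∈ X, ∃ hx : x ≠ 0, Projectivization.mk ℝ x hx = p}

/-- The vertices of the projective convex set given by the cone `T`: the points `p` of it at which
the normal cone has full dimension, i.e. the supporting hyperplanes of `T` through `p` have no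
point other than `p` in common. (A smooth boundary point, for instance an extreme point with only
one supporting hyperplane, is not a vertex. For a polyhedral cone, these are the usual vertices.) -/
def projVertices (T : PointedCone ℝ E) : Set (ℙ ℝ E) :=
  {p | p ∈ projSet (T : Set E) ∧
    ∀ y : E,
      (∀ f : Module.Dual ℝ E, (∀ z ∈ T, 0 ≤ f z) → (∀ x ∈ p.submodule, f x = 0) → f y = 0) →
      y ∈ p.submodule}

/-- `F` is a one-dimensional face of the projective convex set given by the cone `T`: a face of the
cone `T` with a two-dimensional linear span. -/
def IsProjEdge (T F : PointedCone ℝ E) : Prop :=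
  F.IsFaceOf T ∧ Module.finrank ℝ (Submodule.span ℝ (F : Set E)) = 2

/-- The `1`-skeleton of the projective convex set given by the cone `T`: two distinct vertices are
adjacent if they lie on a common edge (they are then its two ends). -/
def projSkeleton (T : PointedCone ℝ E) : SimpleGraph (projVertices T) where
  Adj p q := p ≠ q ∧ ∃ F : PointedCone ℝ E, IsProjEdge T F ∧
    (p : ℙ ℝ E) ∈ projSet (F : Set E) ∧ (q : ℙ ℝ E) ∈ projSet (F : Set E)
  symm := ⟨fun _ _ ⟨h, F, hF, hp, hq⟩ => ⟨h.symm, F, hF, hq, hp⟩⟩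
  loopless := ⟨fun _ h => h.1 rfl⟩

end ProjectiveCones

/-- The tangency graph of a set of closed balls with disjoint interiors: two distinct balls are
adjacent if they touch in exactly one point. -/
def tangencyGraph {X : Type*} (P : Set (Set X)) : SimpleGraph P where
  Adj b b' := b ≠ b' ∧ ∃ p : X, (b : Set X) ∩ b' = {p}
  symm := ⟨fun _ _ ⟨h, p, hp⟩ => ⟨h.symm, p, by rw [Set.inter_comm]; exact hp⟩⟩
  loopless := ⟨fun _ h => h.1 rfl⟩

/-! ### Geometric Coxeter systems -/

/-- The data of a geometric Coxeter system: a Coxeter matrix `M` (where the entry `0` stands for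
`∞`), with a number `c s t = c t s ≥ 1` for every pair with `M s t = ∞`. -/
structure GeometricCoxeterMatrix (S : Type*) where
  M : CoxeterMatrix S
  c : S → S → ℝ
  c_symm : ∀ s t, M s t = 0 → c s t = c t s
  one_le_c : ∀ s t, M s t = 0 → 1 ≤ c s t

namespace GeometricCoxeterMatrix

variable {S : Type*} (G : GeometricCoxeterMatrix S)

/-- The matrix `B`. -/
def gram : Matrix S S ℝ :=
  fun s t => if G.M s t = 0 then -G.c s t else -Real.cos (Real.pi / G.M s t)

theorem gram_self (s : S) : G.gram s s = 1 := by
  simp [gram]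

theorem gram_comm (s t : S) : G.gram s t = G.gram t s := by
  unfold gram
  rw [G.M.symmetric t s]
  split_ifs with h
  · rw [G.c_symm s t h]
  · rfl

/-- The Coxeter graph, without its labels. -/
def coxeterGraph : SimpleGraph S where
  Adj s t := s ≠ t ∧ G.M s t ≠ 2
  symm := ⟨fun s t h => ⟨h.1.symm, by rw [G.M.symmetric t s]; exact h.2⟩⟩
  loopless := ⟨fun _ h => h.1 rfl⟩

/-- The Coxeter system is irreducible. -/
def IsIrreducible : Prop := G.coxeterGraph.Connected

variable [Fintype S]

/-- The Coxeter graph is of level `≤ r`: every induced subgraph on `n - r` vertices is of finite or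
affine type, i.e. has a positive semidefinite matrix. -/
def LevelLE (r : ℕ) : Prop :=
  ∀ I : Finset S, I.card + r = Fintype.card S →
    (G.gram.submatrix (Subtype.val : I → S) (Subtype.val : I → S)).PosSemidef

/-- The Coxeter graph is of level `r`. -/
def IsOfLevel (r : ℕ) : Prop := G.LevelLE r ∧ ∀ r' < r, ¬ G.LevelLE r'

variable [DecidableEq S]

/-- The bilinear form `𝓑` on `V = ℝ^S`. -/
def form : LinearMap.BilinForm ℝ (S → ℝ) := Matrix.toBilin' G.gram

/-- The Coxeter system is of Lorentzian type: `𝓑` has signature `(n - 1, 1)`. -/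
def IsLorentzian : Prop :=
  sigPos G.form.toQuadraticMap + 1 = Fintype.card S ∧
    sigNeg G.form.toQuadraticMap = 1

/-- The light cone `Q`. -/
def lightCone : Set (S → ℝ) := {x | G.form x x = 0}

/-- The simple roots: the standard basis of `V = ℝ^S`. -/
def simpleRoot (s : S) : S → ℝ := Pi.single s 1

/-- The linear form `x ↦ 2 𝓑(x, α_s)`, where `𝓑(α_s, α_s) = 1`. -/
def coroot (s : S) : Module.Dual ℝ (S → ℝ) := (2 : ℝ) • G.form.flip (simpleRoot s)

theorem form_simpleRoot (s t : S) : G.form (simpleRoot s) (simpleRoot t) = G.gram s t := by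
  simp [form, simpleRoot]

theorem coroot_simpleRoot (s t : S) : G.coroot s (simpleRoot t) = 2 * G.gram s t := by
  simp [coroot, form_simpleRoot, G.gram_comm s t]

theorem coroot_self (s : S) : G.coroot s (simpleRoot s) = 2 := by
  rw [coroot_simpleRoot, gram_self, mul_one]

/-- The reflection `σ_s(x) = x - 2 𝓑(x, α_s) α_s`. -/
def simpleReflection (s : S) : (S → ℝ) ≃ₗ[ℝ] (S → ℝ) := Module.reflection (G.coroot_self s)

theorem simpleReflection_apply (s : S) (x : S → ℝ) :
    G.simpleReflection s x = x - (2 * G.form x (simpleRoot s)) • simpleRoot s := by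
  simp [simpleReflection, Module.reflection_apply, coroot]

theorem isLiftable : G.M.IsLiftable G.simpleReflection := by
  intro i j
  by_cases h0 : G.M i j = 0
  · rw [h0, pow_zero]
  by_cases hij : i = j
  · subst hij
    rw [G.M.diagonal, pow_one]
    exact LinearEquiv.ext fun x => Module.involutive_reflection (G.coroot_self i) x
  have h1 : G.M i j ≠ 1 := G.M.off_diagonal i j hij
  have hg : G.gram i j = -Real.cos (Real.pi / G.M i j) := by simp [gram, h0]
  refine LinearEquiv.ext fun z => ?_
  unfold simpleReflection
  rw [Module.reflection_mul_reflection_pow_apply]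
  rw [G.coroot_simpleRoot, G.coroot_simpleRoot, G.gram_comm j i]
  generalize hm : G.M i j = m at *
  by_cases h2 : m = 2
  · subst h2
    have hz : G.gram i j = 0 := by rw [hg]; norm_num
    rw [hz]
    norm_num
    abel
  set θ : ℝ := 2 * (Real.pi / m) with hθ
  have ht : 2 * G.gram i j * (2 * G.gram i j) - 2 = 2 * Real.cos θ := by
    rw [hg, hθ, Real.cos_two_mul]; ring
  have hm3 : 3 ≤ m := by omega
  have hmR : (3 : ℝ) ≤ m := by exact_mod_cast hm3
  have hmθ : (m : ℝ) * θ = 2 * Real.pi := by rw [hθ]; field_simp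
  have hs : Real.sin θ ≠ 0 := by
    apply ne_of_gt
    apply Real.sin_pos_of_pos_of_lt_pi
    · rw [hθ]; have := Real.pi_pos; positivity
    · have h3 : 0 < θ := by rw [hθ]; have := Real.pi_pos; positivity
      nlinarith [Real.pi_pos]
  rw [ht]
  have hS := fun n : ℤ => Polynomial.Chebyshev.S_two_mul_real_cos θ n
  obtain ⟨k, hk | hk⟩ := Nat.even_or_odd' m
  · have e1 : ((m : ℤ) - 2) / 2 = k - 1 := by omega
    have e2 : ((m : ℤ) - 1) / 2 = k - 1 := by omega
    have hz : (Polynomial.Chebyshev.S ℝ ((k : ℤ) - 1)).eval (2 * Real.cos θ) = 0 := by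
      have h := hS ((k : ℤ) - 1)
      have : (((k : ℤ) - 1 : ℤ) + 1 : ℝ) * θ = Real.pi := by
        have : (m : ℝ) = 2 * k := by exact_mod_cast hk
        rw [this] at hmθ
        push_cast; linarith
      rw [this, Real.sin_pi] at h
      exact (mul_eq_zero.mp h).resolve_right hs
    rw [e1, e2, hz]
    simp
  · have e1 : ((m : ℤ) - 2) / 2 = k - 1 := by omega
    have e2 : ((m : ℤ) - 1) / 2 = k := by omega
    have e3 : ((m : ℤ) - 3) / 2 = k - 1 := by omega
    have e4 : (m : ℤ) / 2 = k := by omega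
    have hz : (Polynomial.Chebyshev.S ℝ (k : ℤ)).eval (2 * Real.cos θ) +
        (Polynomial.Chebyshev.S ℝ ((k : ℤ) - 1)).eval (2 * Real.cos θ) = 0 := by
      have h := hS (k : ℤ)
      have h' := hS ((k : ℤ) - 1)
      have e : (((k : ℤ) : ℝ) + 1) * θ = 2 * Real.pi - k * θ := by
        have : (m : ℝ) = 2 * k + 1 := by exact_mod_cast hk
        rw [this] at hmθ
        push_cast; linarith
      rw [e, Real.sin_two_pi_sub] at h
      have e' : (((k : ℤ) - 1 : ℤ) + 1 : ℝ) * θ = k * θ := by push_cast; ring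
      rw [e'] at h'
      refine (mul_eq_zero.mp ?_).resolve_right hs
      rw [add_mul, h, h']; ring
    rw [e1, e2, e3, e4, hz]
    simp

/-- The fundamental weights: `ω_s` is the `s`-th column of `B⁻¹`. -/
def fundamentalWeight (s : S) : S → ℝ := (G.gram⁻¹) *ᵥ simpleRoot s

theorem form_simpleRoot_fundamentalWeight (hB : IsUnit G.gram.det) (s t : S) :
    G.form (simpleRoot s) (G.fundamentalWeight t) = if s = t then 1 else 0 := by
  rw [form, Matrix.toBilin'_apply', fundamentalWeight, Matrix.mulVec_mulVec,
    Matrix.mul_nonsing_inv _ hB, Matrix.one_mulVec]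
  simp [simpleRoot, Pi.single_apply, eq_comm]

/-- `c` gives a height function `h(x) = ∑ c_s x_s`: a positively weighted sum of the coordinates,
such that the hyperplane `h = 0` meets the light cone only at the origin. -/
def IsHeight (c : S → ℝ) : Prop :=
  (∀ s, 0 < c s) ∧ ∀ x ∈ G.lightCone, ∑ s, c s * x s = 0 → x = 0

/-- A vector is future-directed if it has positive height. -/
def FutureDirected (x : S → ℝ) : Prop := ∃ c, G.IsHeight c ∧ 0 < ∑ s, c s * x s

/-- The ball of a space-like vector `ω`: the closed cap cut out of the projective light cone by the
half-space `𝓑(ω, x) ≤ 0`, where a point of the projective light cone is represented by a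
future-directed vector `x`. -/
def ball (ω : S → ℝ) : Set (ℙ ℝ (S → ℝ)) :=
  projSet {x | x ∈ G.lightCone ∧ G.FutureDirected x ∧ G.form ω x ≤ 0}

variable {G} {W : Type*} [Group W] (cs : CoxeterSystem G.M W)

/-- The geometric representation of the Coxeter group `W` on `V = ℝ^S`. -/
def geometricRep : W →* ((S → ℝ) ≃ₗ[ℝ] (S → ℝ)) :=
  cs.lift ⟨G.simpleReflection, G.isLiftable⟩

/-- The weights. -/
def weights : Set (S → ℝ) := {x | ∃ (w : W) (s : S), x = geometricRep cs w (G.fundamentalWeight s)}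

/-- The space-like weights. -/
def spaceLikeWeights : Set (S → ℝ) := {ω | ω ∈ weights cs ∧ 0 < G.form ω ω}

/-- The Tits cone: the closed convex cone spanned by the weights. -/
def titsCone : PointedCone ℝ (S → ℝ) := (PointedCone.hull ℝ (weights cs)).closure

/-- The Boyd–Maxwell packing: the set of balls of the space-like weights. -/
def boydMaxwell : Set (Set (ℙ ℝ (S → ℝ))) := G.ball '' spaceLikeWeights cs

end GeometricCoxeterMatrix

end

noncomputable section

namespace GeometricCoxeterMatrix

variable {S : Type*} (G : GeometricCoxeterMatrix S)

/-! ### The Gram matrix and the bilinear form -/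

/-! Write B for the form and call x causal if B(x,x) ≤ 0. A positive eigenvector `v` of the Gram
matrix with negative eigenvalue is time-like and fixes a time orientation. `pastCone` is the set of
causal vectors on the side opposite to `v`; the weights lie on that side, since B(ω_s, v) = v_s > 0
and W only moves ω_s in a way compatible with `v`. The Tits cone T is then caught between two
bounds.

Inner bound (`pastCone_subset_titsCone`): T contains the past cone. Dually, a vector that pairs
nonnegatively with all space-like weights is future causal (`neg_mem_pastCone_of_dual`). Hence T is
already generated by the space-like weights, the other weights being past causal.

Outer bound (`orthProj_mem_pastCone`): projecting T along a space-like weight ω onto its orthogonal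
complement lands in the past cone. This is where level 2 enters: if two fundamental weights spanned
a positive definite plane, its complement would contain a time-like vector with two zero
coordinates.

Together they say that T seen from ω is exactly the round past cone of the hyperplane orthogonal to
ω. So ω is a vertex. A space-like x in T splits as aω + π with a > 0 and π past, so it is no vertex
unless proportional to ω, and a causal point has too few supporting hyperplanes to be one. An edge
contains a space-like weight ω and a boundary ray π of the round cone, and the plane of ω and π is
tangent to the light cone. For two weights ω, ω', lying on a common edge and having tangent balls
both amount to the projection of ω' being light-like.

Both bounds rest on one device, `exists_isMinOn_level`. On a closed invariant cone, minimise a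
positive functional on a level set of the norm; the minimiser lies in a chamber, where its norm can
be read off, and it has the norm of the given vector. This takes the place of discreteness of
orbits. -/

theorem gram_nonpos {s t : S} (h : s ≠ t) : G.gram s t ≤ 0 := by
  unfold gram
  split_ifs with h0
  · linarith [G.one_le_c s t h0]
  · have h1 : G.M s t ≠ 1 := G.M.off_diagonal s t h
    have h2 : (2 : ℝ) ≤ G.M s t := by exact_mod_cast (by omega : 2 ≤ G.M s t)
    have : Real.pi / G.M s t ≤ Real.pi / 2 :=
      div_le_div_of_nonneg_left Real.pi_pos.le two_pos h2
    have h3 : 0 ≤ Real.pi / G.M s t := by positivity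
    linarith [Real.cos_nonneg_of_neg_pi_div_two_le_of_le
      (by linarith [Real.pi_pos] : -(Real.pi / 2) ≤ Real.pi / G.M s t) this]

theorem gram_neg_of_adj {s t : S} (h : G.coxeterGraph.Adj s t) : G.gram s t < 0 := by
  obtain ⟨hst, hM⟩ : s ≠ t ∧ G.M s t ≠ 2 := h
  unfold gram
  split_ifs with h0
  · linarith [G.one_le_c s t h0]
  · have h1 : G.M s t ≠ 1 := G.M.off_diagonal s t hst
    have h2 : (2 : ℝ) < G.M s t := by exact_mod_cast (by omega : 2 < G.M s t)
    have : Real.pi / G.M s t < Real.pi / 2 :=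
      div_lt_div_of_pos_left Real.pi_pos two_pos h2
    have h3 : 0 ≤ Real.pi / G.M s t := by positivity
    linarith [Real.cos_pos_of_mem_Ioo
      ⟨(by linarith [Real.pi_pos] : -(Real.pi / 2) < Real.pi / G.M s t), this⟩]

theorem simpleRoot_nonneg [DecidableEq S] (s : S) : 0 ≤ simpleRoot s := by
  unfold simpleRoot
  exact Pi.single_nonneg.2 zero_le_one

/-- Applied with `m` the order of st, so that the longest dihedral word can be split off the right
end of a longer alternating word. -/
theorem exists_wordProd_alternatingWord_add {G : GeometricCoxeterMatrix S} {W : Type*} [Group W]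
    (cs : CoxeterSystem G.M W) (s t : S) (m j : ℕ) :
    ∃ r : W, cs.length r ≤ j ∧ cs.wordProd (CoxeterSystem.alternatingWord s t (m + j)) =
      r * cs.wordProd (CoxeterSystem.alternatingWord s t m) := by
  induction j with
  | zero => exact ⟨1, by simp, by simp⟩
  | succ j ih =>
    obtain ⟨r, hr, h⟩ := ih
    refine ⟨cs.simple (if Even (m + j) then t else s) * r, ?_, ?_⟩
    · have := cs.length_mul_le (cs.simple (if Even (m + j) then t else s)) r
      rw [cs.length_simple] at this
      omega
    · rw [← add_assoc, CoxeterSystem.alternatingWord_succ', cs.wordProd_cons, h, mul_assoc]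

variable [Fintype S] [DecidableEq S]

theorem form_comm (x y : S → ℝ) : G.form x y = G.form y x := by
  have h : G.gramᵀ = G.gram := by
    ext s t
    exact G.gram_comm t s
  rw [form, Matrix.toBilin'_apply', Matrix.toBilin'_apply', Matrix.dotProduct_mulVec,
    ← Matrix.mulVec_transpose, h, dotProduct_comm]

theorem eq_sum_smul_simpleRoot (x : S → ℝ) : x = ∑ s, x s • simpleRoot s := by
  ext t
  simp [simpleRoot, Finset.sum_apply, Pi.single_apply]

theorem form_eq_sum (x y : S → ℝ) : G.form x y = ∑ s, y s * G.form x (simpleRoot s) := by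
  conv_lhs => rw [eq_sum_smul_simpleRoot y]
  simp

theorem form_simpleRoot_eq_sum (x : S → ℝ) (t : S) :
    G.form x (simpleRoot t) = ∑ s, x s * G.gram s t := by
  rw [form_comm, form_eq_sum]
  exact Finset.sum_congr rfl fun s _ => by rw [form_simpleRoot, gram_comm]

theorem form_simpleRoot_nonpos {x : S → ℝ} (hx : 0 ≤ x) {t : S} (ht : x t = 0) :
    G.form x (simpleRoot t) ≤ 0 := by
  rw [form_simpleRoot_eq_sum]
  refine Finset.sum_nonpos fun s _ => ?_
  by_cases h : s = t
  · rw [h, ht, zero_mul]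
  · exact mul_nonpos_of_nonneg_of_nonpos (hx s) (G.gram_nonpos h)

theorem form_simpleReflection (s : S) (x y : S → ℝ) :
    G.form (G.simpleReflection s x) (G.simpleReflection s y) = G.form x y := by
  simp only [simpleReflection_apply, map_sub, map_smul, LinearMap.sub_apply, LinearMap.smul_apply,
    smul_eq_mul, form_simpleRoot, gram_self]
  rw [G.form_comm (simpleRoot s) y]
  ring

theorem continuous_form_left (y : S → ℝ) : Continuous fun x => G.form x y :=
  (G.form.flip y).continuous_of_finiteDimensional

theorem continuous_form_right (y : S → ℝ) : Continuous fun x => G.form y x :=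
  (G.form y).continuous_of_finiteDimensional

theorem continuous_form_self : Continuous fun x => G.form x x := by
  have h : (fun x => G.form x x) = fun x => ∑ s, x s * G.form x (simpleRoot s) :=
    funext fun x => G.form_eq_sum x x
  rw [h]
  exact continuous_finsetSum _ fun s _ =>
    (continuous_apply s).mul (G.continuous_form_left _)

/-! ### The Coxeter group acts by isometries -/

variable {G} {W : Type*} [Group W] (cs : CoxeterSystem G.M W)

theorem geometricRep_simple (s : S) : geometricRep cs (cs.simple s) = G.simpleReflection s :=
  cs.lift_apply_simple G.isLiftable s

theorem geometricRep_mul_apply (w w' : W) (x : S → ℝ) :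
    geometricRep cs (w * w') x = geometricRep cs w (geometricRep cs w' x) := by
  rw [map_mul]; rfl

theorem geometricRep_one_apply (x : S → ℝ) : geometricRep cs 1 x = x := by
  rw [map_one]; rfl

theorem form_geometricRep (w : W) (x y : S → ℝ) :
    G.form (geometricRep cs w x) (geometricRep cs w y) = G.form x y := by
  induction w using cs.simple_induction_left generalizing x y with
  | one => simp
  | mul_simple_left w s ih =>
    rw [geometricRep_mul_apply, geometricRep_mul_apply, geometricRep_simple,
      form_simpleReflection, ih]

theorem form_geometricRep_left (w : W) (x y : S → ℝ) :
    G.form (geometricRep cs w x) y = G.form x (geometricRep cs w⁻¹ y) := by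
  rw [← form_geometricRep cs w⁻¹, ← geometricRep_mul_apply, inv_mul_cancel,
    geometricRep_one_apply]

/-! ### Positive roots -/

/-- The coefficients of the roots of a dihedral group, `U_{k-1}(c)`. -/
def dihedralCoeff (c : ℝ) (k : ℕ) : ℝ := (Polynomial.Chebyshev.U ℝ ((k : ℤ) - 1)).eval c

theorem dihedralCoeff_zero (c : ℝ) : dihedralCoeff c 0 = 0 := by simp [dihedralCoeff]

theorem dihedralCoeff_one (c : ℝ) : dihedralCoeff c 1 = 1 := by simp [dihedralCoeff]

theorem dihedralCoeff_add_two (c : ℝ) (k : ℕ) :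
    dihedralCoeff c (k + 2) = 2 * c * dihedralCoeff c (k + 1) - dihedralCoeff c k := by
  have h := Polynomial.Chebyshev.U_add_two ℝ ((k : ℤ) - 1)
  have e1 : ((k + 2 : ℕ) : ℤ) - 1 = (k : ℤ) - 1 + 2 := by push_cast; ring
  have e2 : ((k + 1 : ℕ) : ℤ) - 1 = (k : ℤ) - 1 + 1 := by push_cast; ring
  unfold dihedralCoeff
  rw [e1, e2, h]
  simp

theorem dihedralCoeff_nonneg_of_one_le {c : ℝ} (hc : 1 ≤ c) (k : ℕ) : 0 ≤ dihedralCoeff c k := by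
  suffices 0 ≤ dihedralCoeff c k ∧ dihedralCoeff c k ≤ dihedralCoeff c (k + 1) from this.1
  induction k with
  | zero => simp [dihedralCoeff_zero, dihedralCoeff_one]
  | succ k ih =>
    refine ⟨ih.1.trans ih.2, ?_⟩
    rw [dihedralCoeff_add_two]
    nlinarith

/-- For θ = π/m the coefficient is sin(kθ)/sin θ, and kθ ≤ π. -/
theorem dihedralCoeff_cos_nonneg {m k : ℕ} (hm : 2 ≤ m) (hk : k ≤ m) :
    0 ≤ dihedralCoeff (Real.cos (Real.pi / m)) k := by
  have hm' : (2 : ℝ) ≤ m := by exact_mod_cast hm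
  have hk' : (k : ℝ) ≤ m := by exact_mod_cast hk
  have h := Polynomial.Chebyshev.U_real_cos (Real.pi / m) ((k : ℤ) - 1)
  have hs : 0 < Real.sin (Real.pi / m) := by
    apply Real.sin_pos_of_pos_of_lt_pi
    · have := Real.pi_pos; positivity
    · exact div_lt_self Real.pi_pos (by linarith)
  have hsk : 0 ≤ Real.sin (((((k : ℤ) - 1 : ℤ) : ℝ) + 1) * (Real.pi / m)) := by
    have e : ((((k : ℤ) - 1 : ℤ) : ℝ) + 1) * (Real.pi / m) = Real.pi * (k / m) := by
      push_cast; ring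
    rw [e]
    apply Real.sin_nonneg_of_nonneg_of_le_pi
    · have := Real.pi_pos; positivity
    · exact mul_le_of_le_one_right Real.pi_pos.le ((div_le_one (by linarith)).2 hk')
  unfold dihedralCoeff
  rw [← h] at hsk
  exact nonneg_of_mul_nonneg_left hsk hs

theorem geometricRep_alternatingWord (s t : S) (k : ℕ) :
    geometricRep cs (cs.wordProd (CoxeterSystem.alternatingWord s t k)) (simpleRoot s) =
      if Even k then dihedralCoeff (-G.gram s t) (k + 1) • simpleRoot s +
        dihedralCoeff (-G.gram s t) k • simpleRoot t
      else dihedralCoeff (-G.gram s t) (k + 1) • simpleRoot t +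
        dihedralCoeff (-G.gram s t) k • simpleRoot s := by
  induction k with
  | zero =>
    simp [CoxeterSystem.alternatingWord, dihedralCoeff_zero, dihedralCoeff_one]
  | succ k ih =>
    rw [CoxeterSystem.alternatingWord_succ', cs.wordProd_cons, geometricRep_mul_apply, ih,
      geometricRep_simple]
    by_cases hk : Even k
    · have hk' : ¬ Even (k + 1) := by simp [hk, parity_simps]
      rw [if_pos hk, if_pos hk, if_neg hk', dihedralCoeff_add_two, simpleReflection_apply]
      simp only [map_add, map_smul, LinearMap.add_apply, LinearMap.smul_apply, form_simpleRoot,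
        gram_self, smul_eq_mul]
      module
    · have hk' : Even (k + 1) := by simp [hk, parity_simps]
      rw [if_neg hk, if_neg hk, if_pos hk', dihedralCoeff_add_two, simpleReflection_apply]
      simp only [map_add, map_smul, LinearMap.add_apply, LinearMap.smul_apply, form_simpleRoot,
        gram_self, smul_eq_mul, G.gram_comm t s]
      module

/-- Induction on length. Choose a descent t of `w` and factor `w` = u d, with lengths adding up,
where d is an alternating word in s and t that ends in t and is as long as possible. Then neither s
nor t is a descent of the shorter element u, and d sends α_s to a nonnegative combination of α_s and
α_t. -/
theorem geometricRep_simpleRoot_nonneg (w : W) (s : S) (h : ¬ cs.IsRightDescent w s) :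
    0 ≤ geometricRep cs w (simpleRoot s) := by
  induction hn : cs.length w using Nat.strong_induction_on generalizing w s with
  | _ n ih =>
  subst hn
  by_cases hw : w = 1
  · rw [hw, geometricRep_one_apply]
    exact simpleRoot_nonneg s
  obtain ⟨t, ht⟩ := cs.exists_rightDescent_of_ne_one hw
  have hst : s ≠ t := by rintro rfl; exact h ht
  have hsplit := cs.not_isRightDescent_iff.1 h
  let p : ℕ → Prop := fun k => ∃ u : W,
    w = u * cs.wordProd (CoxeterSystem.alternatingWord s t k) ∧ cs.length u + k = cs.length w
  classical
  have hp1 : p 1 := ⟨w * cs.simple t, by simp [CoxeterSystem.alternatingWord], by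
    rw [cs.isRightDescent_iff] at ht; exact ht⟩
  have hple : ∀ k, p k → k ≤ cs.length w := fun k ⟨u, _, hu⟩ => by omega
  obtain ⟨k, hk1, ⟨u, hu, hul⟩, hmax⟩ : ∃ k, 1 ≤ k ∧ p k ∧ ¬ p (k + 1) := by
    refine ⟨Nat.findGreatest p (cs.length w), Nat.le_findGreatest (hple 1 hp1) hp1,
      Nat.findGreatest_spec (hple 1 hp1) hp1, fun hk => ?_⟩
    have := Nat.le_findGreatest (hple _ hk) hk
    omega
  -- This letter could be prepended to the alternating word, against maximality of `k`.
  have hnext : ¬ cs.IsRightDescent u (if Even k then t else s) := fun hd => by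
    rw [cs.isRightDescent_iff] at hd
    refine hmax ⟨u * cs.simple (if Even k then t else s), ?_, by omega⟩
    rw [CoxeterSystem.alternatingWord_succ', cs.wordProd_cons, mul_assoc,
      cs.simple_mul_simple_cancel_left]
    exact hu
  -- This letter would cancel the first letter of the alternating word, making `w` shorter than it
  -- is.
  have hprev : ¬ cs.IsRightDescent u (if Even k then s else t) := fun hd => by
    rw [cs.isRightDescent_iff] at hd
    obtain ⟨j, rfl⟩ : ∃ j, k = j + 1 := ⟨k - 1, by omega⟩
    have e : (if Even (j + 1) then s else t) = if Even j then t else s := by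
      by_cases hj : Even j <;> simp [hj, parity_simps]
    rw [CoxeterSystem.alternatingWord_succ', cs.wordProd_cons, ← mul_assoc, ← e] at hu
    have h1 := cs.length_mul_le (u * cs.simple (if Even (j + 1) then s else t))
      (cs.wordProd (CoxeterSystem.alternatingWord s t j))
    have h2 := cs.length_wordProd_le (CoxeterSystem.alternatingWord s t j)
    rw [CoxeterSystem.length_alternatingWord] at h2
    rw [← hu] at h1
    omega
  have hus : ¬ cs.IsRightDescent u s ∧ ¬ cs.IsRightDescent u t := by
    by_cases hk : Even k
    · rw [if_pos hk] at hnext hprev; exact ⟨hprev, hnext⟩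
    · rw [if_neg hk] at hnext hprev; exact ⟨hnext, hprev⟩
  have hs0 := ih _ (by omega) u s hus.1 rfl
  have ht0 := ih _ (by omega) u t hus.2 rfl
  have hcoef : 0 ≤ dihedralCoeff (-G.gram s t) k ∧ 0 ≤ dihedralCoeff (-G.gram s t) (k + 1) := by
    by_cases hM : G.M s t = 0
    · have : 1 ≤ -G.gram s t := by simp [gram, hM, G.one_le_c s t hM]
      exact ⟨dihedralCoeff_nonneg_of_one_le this _, dihedralCoeff_nonneg_of_one_le this _⟩
    have hM1 : G.M s t ≠ 1 := G.M.off_diagonal s t hst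
    -- Otherwise the braid relation rewrites the end of the word so that it ends in s, and s becomes
    -- a descent of `w`.
    have hkm : k < G.M s t := by
      by_contra! hkm
      obtain ⟨j, rfl⟩ := Nat.exists_eq_add_of_le hkm
      obtain ⟨r, hr, hr'⟩ := exists_wordProd_alternatingWord_add cs s t (G.M s t) j
      have hb : cs.wordProd (CoxeterSystem.alternatingWord s t (G.M s t)) =
          cs.wordProd (CoxeterSystem.alternatingWord s t (G.M s t - 1)) * cs.simple s := by
        have h1 := cs.wordProd_braidWord_eq s t
        unfold CoxeterSystem.braidWord at h1
        rw [h1, G.M.symmetric t s]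
        obtain ⟨m, hm⟩ : ∃ m, G.M s t = m + 1 := ⟨G.M s t - 1, by omega⟩
        rw [hm, CoxeterSystem.alternatingWord_succ, cs.wordProd_concat, Nat.add_sub_cancel]
      rw [hr', hb, ← mul_assoc, ← mul_assoc] at hu
      have hws : w * cs.simple s =
          u * r * cs.wordProd (CoxeterSystem.alternatingWord s t (G.M s t - 1)) := by
        rw [hu, cs.simple_mul_simple_cancel_right]
      have h1 := cs.length_mul_le (u * r)
        (cs.wordProd (CoxeterSystem.alternatingWord s t (G.M s t - 1)))
      have h2 := cs.length_wordProd_le (CoxeterSystem.alternatingWord s t (G.M s t - 1))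
      rw [CoxeterSystem.length_alternatingWord] at h2
      have h3 := cs.length_mul_le u r
      rw [← hws] at h1
      omega
    have hg : -G.gram s t = Real.cos (Real.pi / G.M s t) := by simp [gram, hM]
    rw [hg]
    exact ⟨dihedralCoeff_cos_nonneg (by omega) hkm.le, dihedralCoeff_cos_nonneg (by omega) hkm⟩
  rw [hu, geometricRep_mul_apply, geometricRep_alternatingWord]
  split_ifs
  · rw [map_add, map_smul, map_smul]
    exact add_nonneg (smul_nonneg hcoef.2 hs0) (smul_nonneg hcoef.1 ht0)
  · rw [map_add, map_smul, map_smul]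
    exact add_nonneg (smul_nonneg hcoef.2 ht0) (smul_nonneg hcoef.1 hs0)

/-- The elements of the fundamental chamber are maximal in their orbit. -/
theorem geometricRep_le_self {x : S → ℝ} (hx : ∀ s, 0 ≤ G.form x (simpleRoot s)) (w : W) :
    geometricRep cs w x ≤ x := by
  induction hn : cs.length w using Nat.strong_induction_on generalizing w with
  | _ n ih =>
  subst hn
  by_cases hw : w = 1
  · rw [hw, geometricRep_one_apply]
  obtain ⟨s, hs⟩ := cs.exists_rightDescent_of_ne_one hw
  have hlt : cs.length (w * cs.simple s) < cs.length w := hs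
  -- Restoring the letter s subtracts 2 B(x, α_s) times this root from the shorter image of `x`.
  have hpos := geometricRep_simpleRoot_nonneg cs (w * cs.simple s) s
    (cs.isRightDescent_iff_not_isRightDescent_mul.1 hs)
  have e : geometricRep cs w x = geometricRep cs (w * cs.simple s) x -
      (2 * G.form x (simpleRoot s)) • geometricRep cs (w * cs.simple s) (simpleRoot s) := by
    conv_lhs => rw [← cs.simple_mul_simple_cancel_right (w := w) s]
    rw [geometricRep_mul_apply, geometricRep_simple, simpleReflection_apply, map_sub, map_smul]
  rw [e]
  have h1 := ih _ hlt _ rfl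
  have h2 := smul_nonneg (mul_nonneg zero_le_two (hx s)) hpos
  exact (sub_le_self _ h2).trans h1

end GeometricCoxeterMatrix

/-! ### Lorentzian forms -/

section LorentzianForms

variable {E : Type*} [AddCommGroup E] [Module ℝ E]

/-- A symmetric bilinear form which is positive definite on the orthogonal complement of every
vector of negative norm. -/
structure IsLorentzForm (B : LinearMap.BilinForm ℝ E) : Prop where
  symm : ∀ x y, B x y = B y x
  pos_of_orthogonal : ∀ {x y}, B x x < 0 → B x y = 0 → y ≠ 0 → 0 < B y y

/-- The causal vectors on the side of `-v`. -/
def pastCone (B : LinearMap.BilinForm ℝ E) (v : E) : Set E := {x | B x x ≤ 0 ∧ 0 ≤ B x v}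

theorem exists_ne_zero_of_two_functionals [FiniteDimensional ℝ E] (hE : 3 ≤ Module.finrank ℝ E)
    (f g : Module.Dual ℝ E) : ∃ u : E, u ≠ 0 ∧ f u = 0 ∧ g u = 0 := by
  have h : LinearMap.ker (f.prod g) ≠ ⊥ :=
    LinearMap.ker_ne_bot_of_finrank_lt (by simp; omega)
  obtain ⟨u, hu, hu0⟩ := Submodule.exists_mem_ne_zero_of_ne_bot h
  exact ⟨u, hu0, Prod.mk_eq_zero.1 (LinearMap.mem_ker.1 hu)⟩

namespace IsLorentzForm

variable {B : LinearMap.BilinForm ℝ E} {v : E}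

theorem form_add_self (hB : IsLorentzForm B)
    (x y : E) : B (x + y) (x + y) = B x x + 2 * B x y + B y y := by
  simp only [map_add, LinearMap.add_apply]
  rw [hB.symm y x]; ring

theorem form_add_smul_self (hB : IsLorentzForm B) (x y : E) (t : ℝ) :
    B (x + t • y) (x + t • y) = B x x + 2 * t * B x y + t ^ 2 * B y y := by
  rw [hB.form_add_self]
  simp only [map_smul, LinearMap.smul_apply, smul_eq_mul]; ring

theorem orthogonal_nonneg (hB : IsLorentzForm B)
    {x y : E} (hx : B x x < 0) (hxy : B x y = 0) : 0 ≤ B y y := by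
  by_cases h : y = 0
  · simp [h]
  · exact (hB.pos_of_orthogonal hx hxy h).le

theorem eq_zero_of_orthogonal (hB : IsLorentzForm B)
    {x y : E} (hx : B x x < 0) (hxy : B x y = 0) (hy : B y y ≤ 0) :
    y = 0 := by
  by_contra h
  exact (hB.pos_of_orthogonal hx hxy h).not_ge hy

/-- The orthogonal complement of a space-like vector contains the projection of a time-like one,
which is again time-like. -/
theorem projection_neg (hB : IsLorentzForm B) {x e : E} (he : B e e < 0) (hx : 0 < B x x) :
    B (e - (B e x / B x x) • x) (e - (B e x / B x x) • x) < 0 := by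
  rw [sub_eq_add_neg, ← neg_smul, hB.form_add_smul_self]
  have : 0 ≤ (B e x) ^ 2 / B x x := by positivity
  have e1 : 2 * -(B e x / B x x) * B e x + (-(B e x / B x x)) ^ 2 * B x x =
      -((B e x) ^ 2 / B x x) := by field_simp; ring
  linarith

theorem projection_orthogonal {x : E} (e : E) (hx : 0 < B x x) :
    B (e - (B e x / B x x) • x) x = 0 := by
  simp only [map_sub, map_smul, LinearMap.sub_apply, LinearMap.smul_apply, smul_eq_mul]
  field_simp
  ring

theorem exists_lightlike (hB : IsLorentzForm B)
    {e u : E} (he : B e e < 0) (hu : u ≠ 0) (heu : B e u = 0) :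
    ∃ t : ℝ, 0 < t ∧ B (e + t • u) (e + t • u) = 0 ∧ B (e - t • u) (e - t • u) = 0 := by
  have hu' := hB.pos_of_orthogonal he heu hu
  have hq : 0 < -B e e / B u u := div_pos (by linarith) hu'
  have hsq : Real.sqrt (-B e e / B u u) ^ 2 * B u u = -B e e := by
    rw [Real.sq_sqrt hq.le]; field_simp
  refine ⟨Real.sqrt (-B e e / B u u), Real.sqrt_pos.2 hq, ?_, ?_⟩
  · rw [hB.form_add_smul_self, heu, hsq]; ring
  · rw [sub_eq_add_neg, ← neg_smul, hB.form_add_smul_self, heu, neg_sq, hsq]; ring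

/-! ### Past causal vectors -/

theorem past_pos (hB : IsLorentzForm B) (hv : B v v < 0)
    {x : E} (hx : x ∈ pastCone B v) (h0 : x ≠ 0) : 0 < B x v := by
  refine lt_of_le_of_ne hx.2 fun h => h0 ?_
  exact hB.eq_zero_of_orthogonal hv (by rw [hB.symm, ← h]) hx.1

/-- The combination B(y,v)x − B(x,v)y is orthogonal to the time-like `v`, so its norm is
nonnegative. This serves as a reversed Cauchy–Schwarz inequality for past vectors. -/
theorem form_past_combination (hB : IsLorentzForm B) (hv : B v v < 0) {x y : E} :
    0 ≤ B y v ^ 2 * B x x - 2 * (B x v * B y v) * B x y + B x v ^ 2 * B y y := by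
  have h := hB.orthogonal_nonneg hv (y := B y v • x - B x v • y) (by
    rw [map_sub, map_smul, map_smul, hB.symm v x, hB.symm v y]; simp [mul_comm])
  simp only [map_sub, map_smul, LinearMap.sub_apply, LinearMap.smul_apply, smul_eq_mul,
    hB.symm y x] at h
  linarith

theorem past_form_nonpos (hB : IsLorentzForm B) (hv : B v v < 0)
    {x y : E} (hx : x ∈ pastCone B v) (hy : y ∈ pastCone B v) :
    B x y ≤ 0 := by
  by_cases hx0 : x = 0
  · simp [hx0]
  by_cases hy0 : y = 0
  · simp [hy0]
  have h := hB.form_past_combination hv (x := x) (y := y)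
  have h1 := hB.past_pos hv hx hx0
  have h2 := hB.past_pos hv hy hy0
  have h3 := mul_pos h1 h2
  have h4 : B y v ^ 2 * B x x ≤ 0 := mul_nonpos_of_nonneg_of_nonpos (sq_nonneg _) hx.1
  have h5 : B x v ^ 2 * B y y ≤ 0 := mul_nonpos_of_nonneg_of_nonpos (sq_nonneg _) hy.1
  by_contra! h6
  nlinarith [mul_pos h3 h6]

/-- The combination B(y,v)x − B(x,v)y is orthogonal to `v`, and it is causal once B(x,y) = 0, so it
vanishes. -/
theorem past_proportional (hB : IsLorentzForm B) (hv : B v v < 0)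
    {x y : E} (hx : x ∈ pastCone B v) (hy : y ∈ pastCone B v)
    (hx0 : x ≠ 0) (hxy : B x y = 0) : ∃ c : ℝ, 0 ≤ c ∧ y = c • x := by
  have h1 := hB.past_pos hv hx hx0
  refine ⟨B y v / B x v, div_nonneg hy.2 h1.le, ?_⟩
  have h : B y v • x - B x v • y = 0 := by
    refine hB.eq_zero_of_orthogonal hv ?_ ?_
    · rw [map_sub, map_smul, map_smul, hB.symm v x, hB.symm v y]; simp [mul_comm]
    · simp only [map_sub, map_smul, LinearMap.sub_apply, LinearMap.smul_apply, smul_eq_mul,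
        hB.symm y x, hxy]
      have h4 : B y v ^ 2 * B x x ≤ 0 := mul_nonpos_of_nonneg_of_nonpos (sq_nonneg _) hx.1
      have h5 : B x v ^ 2 * B y y ≤ 0 := mul_nonpos_of_nonneg_of_nonpos (sq_nonneg _) hy.1
      nlinarith
  rw [sub_eq_zero] at h
  rw [div_eq_inv_mul, mul_smul, h, smul_smul, inv_mul_cancel₀ h1.ne', one_smul]

theorem past_add (hB : IsLorentzForm B) (hv : B v v < 0)
    {x y : E} (hx : x ∈ pastCone B v) (hy : y ∈ pastCone B v) :
    x + y ∈ pastCone B v := by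
  refine ⟨?_, ?_⟩
  · rw [hB.form_add_self]
    linarith [hx.1, hy.1, hB.past_form_nonpos hv hx hy]
  · rw [map_add, LinearMap.add_apply]
    exact add_nonneg hx.2 hy.2

theorem past_smul {x : E} (hx : x ∈ pastCone B v) {c : ℝ} (hc : 0 ≤ c) :
    c • x ∈ pastCone B v := by
  refine ⟨?_, ?_⟩
  · simp only [map_smul, LinearMap.smul_apply, smul_eq_mul]
    nlinarith [hx.1, mul_nonneg hc hc]
  · simp only [map_smul, LinearMap.smul_apply, smul_eq_mul]
    exact mul_nonneg hc hx.2

theorem past_sum (hB : IsLorentzForm B) (hv : B v v < 0)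
    {ι : Type*} (I : Finset ι) (f : ι → E) (hf : ∀ i ∈ I, f i ∈ pastCone B v) :
    ∑ i ∈ I, f i ∈ pastCone B v := by
  classical
  induction I using Finset.induction_on with
  | empty => simp [pastCone]
  | insert i I hi ih =>
    rw [Finset.sum_insert hi]
    exact hB.past_add hv (hf i (by simp)) (ih fun j hj => hf j (by simp [hj]))

/-- A causal vector is in the past as soon as some future time-like vector says so. -/
theorem mem_past_of_form_nonneg (hB : IsLorentzForm B) (hv : B v v < 0)
    {x u : E} (hx : B x x ≤ 0) (hu : B u u < 0) (huv : B u v ≤ 0)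
    (hxu : 0 ≤ B x u) : x ∈ pastCone B v := by
  refine ⟨hx, ?_⟩
  by_contra! hxv
  have h1 : -x ∈ pastCone B v := ⟨by simpa using hx, by simp; linarith⟩
  have h2 : -u ∈ pastCone B v := ⟨by simp; linarith, by simpa using huv⟩
  have h3 := hB.past_form_nonpos hv h1 h2
  simp only [map_neg, LinearMap.neg_apply, neg_neg] at h3
  have h4 : x = 0 := hB.eq_zero_of_orthogonal hu (by rw [hB.symm]; linarith) hx
  simp [h4] at hxv

/-- A time-like vector of the past cone is in its interior. -/
theorem exists_perturbation (hB : IsLorentzForm B) (hv : B v v < 0)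
    {x : E} (hx : x ∈ pastCone B v) (hxx : B x x < 0) (z : E) :
    ∃ ε : ℝ, 0 < ε ∧ x + ε • z ∈ pastCone B v ∧ x - ε • z ∈ pastCone B v := by
  have hx0 : x ≠ 0 := by rintro rfl; simp at hxx
  have hxv := hB.past_pos hv hx hx0
  have c1 : Continuous fun t : ℝ => B x x + 2 * t * B x z + t ^ 2 * B z z := by fun_prop
  have c2 : Continuous fun t : ℝ => B x v + t * B z v := by fun_prop
  have e1 := (c1.tendsto 0).eventually_lt_const (u := 0) (by simpa using hxx)
  have e2 := (c2.tendsto 0).eventually_const_lt (u := 0) (by simpa using hxv)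
  obtain ⟨δ, hδ, h⟩ := Metric.eventually_nhds_iff.1 (e1.and e2)
  have key : ∀ t : ℝ, |t| < δ → x + t • z ∈ pastCone B v := fun t ht => by
    have := h (y := t) (by simpa using ht)
    refine ⟨by rw [hB.form_add_smul_self]; exact this.1.le, ?_⟩
    simpa using this.2.le
  refine ⟨δ / 2, by positivity, key _ ?_, ?_⟩
  · rw [abs_of_pos (by positivity)]; linarith
  · rw [sub_eq_add_neg, ← neg_smul]
    refine key _ ?_
    rw [abs_neg, abs_of_pos (by positivity)]; linarith

/-- A time-like vector shows that the form is nondegenerate. -/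
theorem eq_zero_of_forall (hB : IsLorentzForm B)
    {x : E} (hv : B v v < 0) (h : ∀ y, B x y = 0) : x = 0 :=
  hB.eq_zero_of_orthogonal hv (by rw [hB.symm, h]) (h x).le

end IsLorentzForm

end LorentzianForms

/-- A functional that is positive on a closed cone attains its minimum on the level sets of a
continuous function. -/
theorem exists_isMinOn_level {E : Type*} [NormedAddCommGroup E] [NormedSpace ℝ E]
    [FiniteDimensional ℝ E] {X : Set E} (hX : IsClosed X)
    (hsmul : ∀ c : ℝ, 0 ≤ c → ∀ x ∈ X, c • x ∈ X) (f : Module.Dual ℝ E)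
    (hf : ∀ x ∈ X, x ≠ 0 → 0 < f x) {q : E → ℝ} (hq : Continuous q) {z : E} (hz : z ∈ X) :
    ∃ z' ∈ X, q z' = q z ∧ ∀ x ∈ X, q x = q z → f z' ≤ f x := by
  have hfc : Continuous f := f.continuous_of_finiteDimensional
  have : ProperSpace E := FiniteDimensional.proper_real E
  -- Compactness of the unit sphere of `X` makes `f` dominate the norm, so the sublevel sets of `f`
  -- in `X` are compact.
  obtain ⟨δ, hδ, hbound⟩ : ∃ δ : ℝ, 0 < δ ∧ ∀ x ∈ X, δ * ‖x‖ ≤ f x := by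
    have hc : IsCompact (X ∩ Metric.sphere (0 : E) 1) := (isCompact_sphere _ _).inter_left hX
    have hnorm : ∀ x ∈ X, x ≠ 0 → ‖x‖⁻¹ • x ∈ X ∩ Metric.sphere (0 : E) 1 := fun x hx h0 =>
      ⟨hsmul _ (by positivity) x hx, by
        rw [mem_sphere_zero_iff_norm, norm_smul, norm_inv, norm_norm,
          inv_mul_cancel₀ (norm_ne_zero_iff.2 h0)]⟩
    by_cases hne : (X ∩ Metric.sphere (0 : E) 1).Nonempty
    · obtain ⟨x₁, hx₁, hmin⟩ := hc.exists_isMinOn hne hfc.continuousOn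
      have h10 : x₁ ≠ 0 := by
        rintro rfl
        simpa using hx₁.2
      refine ⟨f x₁, hf x₁ hx₁.1 h10, fun x hx => ?_⟩
      by_cases h0 : x = 0
      · simp [h0]
      have h1 : f x₁ ≤ f (‖x‖⁻¹ • x) := hmin (hnorm x hx h0)
      rw [map_smul, smul_eq_mul] at h1
      have h2 : 0 < ‖x‖ := norm_pos_iff.2 h0
      calc f x₁ * ‖x‖ ≤ ‖x‖⁻¹ * f x * ‖x‖ := by gcongr
        _ = f x := by field_simp
    · refine ⟨1, one_pos, fun x hx => ?_⟩
      by_cases h0 : x = 0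
      · simp [h0]
      · exact absurd ⟨_, hnorm x hx h0⟩ hne
  have hcomp : IsCompact (Metric.closedBall (0 : E) (f z / δ) ∩ (X ∩ {x | q x = q z})) :=
    (isCompact_closedBall _ _).inter_right (hX.inter (isClosed_eq hq continuous_const))
  have hin : ∀ x ∈ X, f x ≤ f z → x ∈ Metric.closedBall (0 : E) (f z / δ) := fun x hx hfx => by
    rw [mem_closedBall_zero_iff, le_div_iff₀ hδ, mul_comm]
    exact (hbound x hx).trans hfx
  obtain ⟨z', hz', hmin⟩ := hcomp.exists_isMinOn ⟨z, hin z hz le_rfl, hz, rfl⟩ hfc.continuousOn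
  refine ⟨z', hz'.2.1, hz'.2.2, fun x hx hqx => ?_⟩
  by_cases h : f x ≤ f z
  · exact hmin ⟨hin x hx h, hx, hqx⟩
  · have : f z' ≤ f z := hmin ⟨hin z hz le_rfl, hz, rfl⟩
    linarith

namespace GeometricCoxeterMatrix

variable {S : Type*} (G : GeometricCoxeterMatrix S) [Fintype S] [DecidableEq S]

/-! ### Consequences of the signature -/

variable {G} in
-- A counterexample y would make the form nonpositive on the plane of x and y, which has no room
-- beside a positive part of dimension n − 1.
theorem IsLorentzian.isLorentzForm (h : G.IsLorentzian) : IsLorentzForm G.form where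
  symm := G.form_comm
  pos_of_orthogonal {x y} hx hxy hy := by
    by_contra! hyy
    have hle : ∀ z ∈ Submodule.span ℝ {x, y}, G.form.toQuadraticMap z ≤ 0 := fun z hz => by
      obtain ⟨a, b, rfl⟩ := Submodule.mem_span_pair.1 hz
      simp only [LinearMap.BilinMap.toQuadraticMap_apply, map_add, map_smul, LinearMap.add_apply,
        LinearMap.smul_apply, smul_eq_mul, G.form_comm y x, hxy]
      nlinarith [mul_self_nonneg a, mul_self_nonneg b,
        mul_nonneg (mul_self_nonneg a) (neg_nonneg.2 hx.le),
        mul_nonneg (mul_self_nonneg b) (neg_nonneg.2 hyy)]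
    have hind : LinearIndependent ℝ ![x, y] := by
      refine LinearIndependent.pair_iff.2 fun a b hab => ?_
      have ha : a = 0 := by
        have := congrArg (G.form x) hab
        simp only [map_add, map_smul, smul_eq_mul, hxy, mul_zero, add_zero, map_zero] at this
        exact (mul_eq_zero.1 this).resolve_right hx.ne
      subst ha
      simpa [hy] using hab
    have h2 : Module.finrank ℝ (Submodule.span ℝ {x, y}) = 2 := by
      have := finrank_span_eq_card hind
      rwa [Matrix.range_cons_cons_empty, Fintype.card_fin] at this
    have h3 := QuadraticForm.sigPos_add_finrank_le_of_nonpos hle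
    rw [h2, Module.finrank_fintype_fun_eq_card] at h3
    have := h.1
    omega

variable {G} in
theorem IsLorentzian.exists_form_neg (h : G.IsLorentzian) : ∃ x, G.form x x < 0 := by
  obtain ⟨V, hV, hpos⟩ := exists_finrank_eq_sigNeg_and_negDef G.form.toQuadraticMap
  rw [h.2] at hV
  have : V ≠ ⊥ := by rintro rfl; simp at hV
  obtain ⟨x, hx, hx0⟩ := Submodule.exists_mem_ne_zero_of_ne_bot this
  refine ⟨x, ?_⟩
  have := hpos ⟨x, hx⟩ (by simpa using hx0)
  simpa using this

/-! ### Perron–Frobenius vectors -/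

theorem form_abs_le (x : S → ℝ) : G.form |x| |x| ≤ G.form x x := by
  rw [form_eq_sum, form_eq_sum]
  simp_rw [form_simpleRoot_eq_sum, Finset.mul_sum]
  refine Finset.sum_le_sum fun s _ => Finset.sum_le_sum fun t _ => ?_
  simp only [Pi.abs_apply]
  by_cases h : t = s
  · subst h
    rw [← mul_assoc, ← mul_assoc, abs_mul_abs_self]
  · have := G.gram_nonpos h
    rw [← mul_assoc, ← mul_assoc, ← abs_mul]
    exact mul_le_mul_of_nonpos_right (le_abs_self _) this

/-- Minimise the form on the Euclidean unit sphere of the vectors supported in `J`. Since the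
off-diagonal entries are nonpositive, the absolute value of a minimiser is again one, and the
first-order condition is the eigenvalue equation on `J`. -/
theorem exists_perronFrobenius (J : Set S) {x : S → ℝ} (hx : ∀ s ∉ J, x s = 0)
    (hneg : G.form x x < 0) :
    ∃ (y : S → ℝ) (μ : ℝ), 0 ≤ y ∧ y ≠ 0 ∧ (∀ s ∉ J, y s = 0) ∧ μ < 0 ∧
      ∀ s ∈ J, G.form y (simpleRoot s) = μ * y s := by
  let K : Set (S → ℝ) := {x | (∀ s ∉ J, x s = 0) ∧ ∑ s, x s ^ 2 = 1}
  have hKc : IsCompact K := by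
    refine Metric.isCompact_of_isClosed_isBounded ?_ ?_
    · have h : K = (⋂ s ∈ Jᶜ, {x | x s = 0}) ∩ {x | ∑ s, x s ^ 2 = 1} := by
        ext x; simp [K]
      rw [h]
      exact (isClosed_biInter fun s _ =>
        isClosed_eq (continuous_apply s) continuous_const).inter
        (isClosed_eq (by fun_prop) continuous_const)
    · refine (Metric.isBounded_closedBall (x := (0 : S → ℝ)) (r := 1)).subset fun z hz => ?_
      rw [mem_closedBall_zero_iff, pi_norm_le_iff_of_nonneg zero_le_one]
      intro s
      rw [Real.norm_eq_abs, ← sq_le_one_iff_abs_le_one, ← hz.2]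
      exact Finset.single_le_sum (f := fun s => z s ^ 2) (fun i _ => sq_nonneg _)
        (Finset.mem_univ s)
  have hscale : ∀ z : S → ℝ, (∀ s ∉ J, z s = 0) → z ≠ 0 →
      0 < ∑ s, z s ^ 2 ∧ (Real.sqrt (∑ s, z s ^ 2))⁻¹ • z ∈ K := fun z hz h0 => by
    have hpos : 0 < ∑ s, z s ^ 2 := by
      obtain ⟨s, hs⟩ := Function.ne_iff.1 h0
      exact Finset.sum_pos' (fun i _ => sq_nonneg _) ⟨s, Finset.mem_univ s, by
        have : z s ≠ 0 := hs
        positivity⟩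
    refine ⟨hpos, fun s hs => by simp [hz s hs], ?_⟩
    simp only [Pi.smul_apply, smul_eq_mul, mul_pow, ← Finset.mul_sum, inv_pow]
    rw [Real.sq_sqrt hpos.le, inv_mul_cancel₀ hpos.ne']
  have hx0 : x ≠ 0 := by rintro rfl; simp at hneg
  obtain ⟨x₁, hx₁, hmin⟩ := hKc.exists_isMinOn ⟨_, (hscale x hx hx0).2⟩
    G.continuous_form_self.continuousOn
  set μ := G.form x₁ x₁ with hμ
  have hle : ∀ z : S → ℝ, (∀ s ∉ J, z s = 0) → μ * ∑ s, z s ^ 2 ≤ G.form z z := fun z hz => by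
    by_cases h0 : z = 0
    · simp [h0]
    obtain ⟨hpos, hm⟩ := hscale z hz h0
    have h : μ ≤ _ := hmin hm
    simp only [map_smul, LinearMap.smul_apply, smul_eq_mul] at h
    rw [← mul_assoc, ← mul_inv, Real.mul_self_sqrt hpos.le] at h
    calc μ * ∑ s, z s ^ 2 ≤ (∑ s, z s ^ 2)⁻¹ * G.form z z * ∑ s, z s ^ 2 := by gcongr
      _ = G.form z z := by field_simp
  have hμneg : μ < 0 := by
    have h1 := hle x hx
    have h2 := (hscale x hx hx0).1
    by_contra! h3
    nlinarith [mul_nonneg h3 h2.le]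
  have hyJ : ∀ s ∉ J, |x₁| s = 0 := fun s hs => by simp [hx₁.1 s hs]
  have hy1 : ∑ s, |x₁| s ^ 2 = 1 := by simp [hx₁.2]
  have hyμ : G.form |x₁| |x₁| = μ := le_antisymm (G.form_abs_le x₁) (by
    have := hle _ hyJ
    rwa [hy1, mul_one] at this)
  refine ⟨|x₁|, μ, abs_nonneg x₁, ?_, hyJ, hμneg, fun s hs => ?_⟩
  · intro h
    rw [h] at hy1
    simp at hy1
  have hquad : ∀ ε : ℝ, 0 ≤ ε ^ 2 * (1 - μ) +
      2 * ε * (G.form |x₁| (simpleRoot s) - μ * |x₁| s) := fun ε => by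
    have h := hle (|x₁| + ε • simpleRoot s) fun t ht => by
      have hts : t ≠ s := by rintro rfl; exact ht hs
      simp only [Pi.add_apply, Pi.smul_apply, smul_eq_mul, hyJ t ht, simpleRoot,
        Pi.single_eq_of_ne hts, mul_zero, add_zero]
    have e1 : ∑ t, (|x₁| + ε • simpleRoot s) t ^ 2 = 1 + 2 * ε * |x₁| s + ε ^ 2 := by
      have : ∀ t, (|x₁| + ε • simpleRoot s) t ^ 2 = |x₁| t ^ 2 +
          (2 * ε * |x₁| t + ε ^ 2) * simpleRoot s t := fun t => by
        by_cases hts : t = s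
        · subst hts
          simp only [simpleRoot, Pi.add_apply, Pi.smul_apply, Pi.single_eq_same, smul_eq_mul]
          ring
        · simp [simpleRoot, hts]
      rw [Finset.sum_congr rfl fun t _ => this t, Finset.sum_add_distrib, hy1]
      simp [simpleRoot, Pi.single_apply]
      ring
    rw [e1] at h
    simp only [map_add, map_smul, LinearMap.add_apply, LinearMap.smul_apply, smul_eq_mul,
      form_simpleRoot, gram_self, hyμ, G.form_comm (simpleRoot s) |x₁|] at h
    linarith
  have ha : 0 < 1 - μ := by linarith
  set b := G.form |x₁| (simpleRoot s) - μ * |x₁| s with hb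
  -- This value of ε minimises the quadratic, and the minimum is negative unless `b` = 0.
  have h := hquad (-(b / (1 - μ)))
  have e : (-(b / (1 - μ))) ^ 2 * (1 - μ) + 2 * (-(b / (1 - μ))) * b = -(b ^ 2 / (1 - μ)) := by
    field_simp; ring
  rw [e] at h
  have hb2 : b ^ 2 / (1 - μ) = 0 := le_antisymm (by linarith) (by positivity)
  have hb0 : b = 0 := by
    rcases div_eq_zero_iff.1 hb2 with h | h
    · exact pow_eq_zero_iff two_ne_zero |>.1 h
    · exact absurd h ha.ne'
  linarith

end GeometricCoxeterMatrix

namespace GeometricCoxeterMatrix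

variable {S : Type*} {G : GeometricCoxeterMatrix S} [Fintype S] [DecidableEq S]

/-! ### Perron vectors and the time orientation -/

variable (G) in
/-- A positive eigenvector of the Gram matrix for a negative eigenvalue. -/
structure IsPerronVector (v : S → ℝ) : Prop where
  pos : ∀ s, 0 < v s
  eigen : ∃ μ < 0, ∀ s, G.form v (simpleRoot s) = μ * v s

theorem IsPerronVector.form_simpleRoot_neg {v : S → ℝ} (hv : G.IsPerronVector v) (s : S) :
    G.form v (simpleRoot s) < 0 := by
  obtain ⟨μ, hμ, h⟩ := hv.eigen
  rw [h]
  exact mul_neg_of_neg_of_pos hμ (hv.pos s)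

theorem IsPerronVector.form_self_neg {v : S → ℝ} [Nonempty S] (hv : G.IsPerronVector v) :
    G.form v v < 0 := by
  rw [form_eq_sum]
  exact Finset.sum_neg (fun s _ => mul_neg_of_pos_of_neg (hv.pos s) (hv.form_simpleRoot_neg s))
    Finset.univ_nonempty

/-- At a zero coordinate s the eigenvalue equation is a sum of nonpositive terms equal to 0, so the
coordinates at all neighbours of s vanish too. By connectedness one zero would make the whole vector
zero. -/
theorem exists_isPerronVector (hirr : G.IsIrreducible) (hlor : G.IsLorentzian) :
    ∃ v, G.IsPerronVector v := by
  obtain ⟨x, hx⟩ := hlor.exists_form_neg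
  obtain ⟨y, μ, hy, hy0, -, hμ, h⟩ := G.exists_perronFrobenius Set.univ (by simp) hx
  have hstep : ∀ s t, G.coxeterGraph.Adj s t → y s = 0 → y t = 0 := fun s t hst hs => by
    have h1 := h s (Set.mem_univ s)
    rw [hs, mul_zero, form_simpleRoot_eq_sum] at h1
    have h2 : ∀ u ∈ Finset.univ, y u * G.gram u s ≤ 0 := fun u _ => by
      by_cases hus : u = s
      · rw [hus, hs, zero_mul]
      · exact mul_nonpos_of_nonneg_of_nonpos (hy u) (G.gram_nonpos hus)
    have h3 := (Finset.sum_eq_zero_iff_of_nonpos h2).1 h1 t (Finset.mem_univ t)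
    exact (mul_eq_zero.1 h3).resolve_right (G.gram_neg_of_adj hst.symm).ne
  refine ⟨y, fun s => lt_of_le_of_ne (hy s) fun hs => hy0 ?_, μ, hμ, fun s => h s (Set.mem_univ s)⟩
  ext t
  obtain ⟨p⟩ := hirr.preconnected s t
  have hs' : y s = 0 := hs.symm
  clear hs
  induction p with
  | nil => exact hs'
  | cons hadj _ ih => exact ih (hstep _ _ hadj hs')

/-! ### Fundamental weights -/

theorem IsLorentzian.isUnit_det (hlor : G.IsLorentzian) : IsUnit G.gram.det := by
  obtain ⟨v, hv⟩ := hlor.exists_form_neg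
  rw [isUnit_iff_ne_zero]
  intro h
  obtain ⟨x, hx0, hx⟩ := Matrix.exists_mulVec_eq_zero_iff.2 h
  refine hx0 (hlor.isLorentzForm.eq_zero_of_forall hv fun y => ?_)
  rw [form_comm, form, Matrix.toBilin'_apply', hx, dotProduct_zero]

theorem form_fundamentalWeight (hlor : G.IsLorentzian) (x : S → ℝ) (s : S) :
    G.form x (G.fundamentalWeight s) = x s := by
  rw [form_comm, form_eq_sum]
  have h := fun t => G.form_simpleRoot_fundamentalWeight hlor.isUnit_det t s
  simp [G.form_comm (G.fundamentalWeight s), h]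

theorem form_fundamentalWeight_simpleRoot (hlor : G.IsLorentzian) (s t : S) :
    G.form (G.fundamentalWeight s) (simpleRoot t) = if t = s then 1 else 0 := by
  rw [form_comm]
  exact G.form_simpleRoot_fundamentalWeight hlor.isUnit_det t s

theorem eq_sum_smul_fundamentalWeight (hlor : G.IsLorentzian) (x : S → ℝ) :
    x = ∑ s, G.form x (simpleRoot s) • G.fundamentalWeight s := by
  obtain ⟨v, hv⟩ := hlor.exists_form_neg
  rw [← sub_eq_zero]
  refine hlor.isLorentzForm.eq_zero_of_forall hv fun y => ?_
  rw [form_eq_sum]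
  refine Finset.sum_eq_zero fun t _ => ?_
  simp [LinearMap.sub_apply, LinearMap.sum_apply, form_fundamentalWeight_simpleRoot hlor]

theorem fundamentalWeight_ne_zero (hlor : G.IsLorentzian) (s : S) : G.fundamentalWeight s ≠ 0 := by
  intro h
  have := form_fundamentalWeight_simpleRoot hlor s s
  simp [h] at this

/-! ### Positive semidefinite principal submatrices -/

theorem posSemidef_submatrix_iff (I : Finset S) :
    (G.gram.submatrix (Subtype.val : I → S) (Subtype.val : I → S)).PosSemidef ↔
      ∀ x : S → ℝ, (∀ s ∉ I, x s = 0) → 0 ≤ G.form x x := by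
  have key : ∀ x : S → ℝ, (∀ s ∉ I, x s = 0) → G.form x x =
      (fun i : I => x i) ⬝ᵥ (G.gram.submatrix (Subtype.val : I → S) (Subtype.val : I → S) *ᵥ
        fun i : I => x i) := fun x hx => by
    have hsum : ∀ f : S → ℝ, (∀ s ∉ I, f s = 0) → ∑ s, f s = ∑ i : I, f i := fun f hf => by
      rw [Finset.sum_coe_sort I f]
      exact (Finset.sum_subset (Finset.subset_univ I) fun s _ hs => hf s hs).symm
    rw [form_eq_sum, hsum _ fun s hs => by rw [hx s hs, zero_mul]]
    refine Finset.sum_congr rfl fun i _ => ?_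
    rw [form_simpleRoot_eq_sum, hsum _ fun s hs => by rw [hx s hs, zero_mul]]
    congr 1
    refine Finset.sum_congr rfl fun j _ => ?_
    change x j * G.gram j i = G.gram i j * x j
    rw [G.gram_comm, mul_comm]
  constructor
  · intro h x hx
    rw [key x hx]
    simpa using h.dotProduct_mulVec_nonneg fun i : I => x i
  · intro h
    refine Matrix.PosSemidef.of_dotProduct_mulVec_nonneg ?_ fun y => ?_
    · ext i j
      simp [G.gram_comm]
    · let x : S → ℝ := fun s => if hs : s ∈ I then y ⟨s, hs⟩ else 0
      have hx : ∀ s ∉ I, x s = 0 := fun s hs => dif_neg hs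
      have hy : (fun i : I => x i) = y := by
        ext i
        simp [x]
      have := h x hx
      rw [key x hx, hy] at this
      simpa using this

theorem LevelLE.form_nonneg (h : G.LevelLE 2) {r s : S} (hrs : r ≠ s) {x : S → ℝ}
    (hr : x r = 0) (hs : x s = 0) : 0 ≤ G.form x x := by
  refine (posSemidef_submatrix_iff ({r, s}ᶜ : Finset S)).1 (h _ ?_) x fun t ht => ?_
  · rw [Finset.card_compl, Finset.card_pair hrs]
    have : ({r, s} : Finset S).card ≤ Fintype.card S := Finset.card_le_univ _
    rw [Finset.card_pair hrs] at this
    omega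
  · simp only [Finset.mem_compl, Finset.mem_insert, Finset.mem_singleton, not_not] at ht
    rcases ht with rfl | rfl
    · exact hr
    · exact hs

theorem exists_form_neg_of_not_levelLE_one (h : ¬ G.LevelLE 1) :
    ∃ (s : S) (x : S → ℝ), x s = 0 ∧ G.form x x < 0 := by
  unfold LevelLE at h
  push Not at h
  obtain ⟨I, hI, hpsd⟩ := h
  rw [posSemidef_submatrix_iff] at hpsd
  push Not at hpsd
  obtain ⟨x, hx, hneg⟩ := hpsd
  obtain ⟨s, hs⟩ : ∃ s, s ∉ I := by
    by_contra! hall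
    rw [Finset.eq_univ_of_forall hall, Finset.card_univ] at hI
    omega
  exact ⟨s, x, hx s hs, hneg⟩

/-- The vectors with vanishing s-coordinate are those orthogonal to ω_s. Failure of level 1 puts a
time-like vector there. -/
theorem exists_spaceLike_fundamentalWeight (hlor : G.IsLorentzian) (hlev : G.IsOfLevel 2) :
    ∃ s, 0 < G.form (G.fundamentalWeight s) (G.fundamentalWeight s) := by
  obtain ⟨s, x, hxs, hneg⟩ := exists_form_neg_of_not_levelLE_one (hlev.2 1 one_lt_two)
  refine ⟨s, hlor.isLorentzForm.pos_of_orthogonal hneg ?_ (fundamentalWeight_ne_zero hlor s)⟩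
  rw [form_fundamentalWeight hlor, hxs]

theorem three_le_card (hlev : G.IsOfLevel 2) : 3 ≤ Fintype.card S := by
  obtain ⟨s, x, hxs, hneg⟩ := exists_form_neg_of_not_levelLE_one (hlev.2 1 one_lt_two)
  by_contra! h
  have h1 : 0 ≤ G.form x x := by
    have hcard : (Finset.univ.erase s).card ≤ 1 := by
      rw [Finset.card_erase_of_mem (Finset.mem_univ s), Finset.card_univ]; omega
    rw [form_eq_sum]
    refine Finset.sum_nonneg fun t _ => ?_
    by_cases hts : t = s
    · rw [hts, hxs, zero_mul]
    · rw [form_simpleRoot_eq_sum, Finset.sum_eq_single t, gram_self, mul_one]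
      · exact mul_self_nonneg _
      · intro u _ hut
        by_cases hus : u = s
        · rw [hus, hxs, zero_mul]
        · exact absurd (Finset.card_le_one.1 hcard u (by simp [hus]) t (by simp [hts])) hut
      · simp
  exact hneg.not_ge h1

/-- A fundamental weight that is not space-like is a nonpositive combination of simple roots. -/
theorem fundamentalWeight_nonpos (hlor : G.IsLorentzian) {v : S → ℝ} (hv : G.IsPerronVector v)
    {r : S} (hr : G.form (G.fundamentalWeight r) (G.fundamentalWeight r) ≤ 0) :
    G.fundamentalWeight r ≤ 0 := by
  have hne : Nonempty S := ⟨r⟩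
  have hB := hlor.isLorentzForm
  have hvv := hv.form_self_neg
  set ω := G.fundamentalWeight r with hω
  have hωr : ω r ≤ 0 := by rw [← form_fundamentalWeight hlor ω r]; exact hr
  -- Split ω = P − N into positive and negative parts. On the support of P one has N_u = 0 and B(ω,
  -- α_u) = 0, so B(P, α_u) = B(N, α_u) ≤ 0, and P is causal.
  let P : S → ℝ := ω ⊔ 0
  have hP0 : 0 ≤ P := le_sup_right
  have hN0 : 0 ≤ P - ω := sub_nonneg.2 le_sup_left
  have hPr : P r = 0 := by simp [P, hωr]
  have hPN : ∀ u, P u ≠ 0 → (P - ω) u = 0 := fun u hu => by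
    by_cases h : ω u ≤ 0
    · simp [P, h] at hu
    · simp [P, (not_le.1 h).le]
  have hPP : G.form P P ≤ 0 := by
    rw [form_eq_sum]
    refine Finset.sum_nonpos fun u _ => ?_
    by_cases hu : P u = 0
    · rw [hu, zero_mul]
    have hur : u ≠ r := by rintro rfl; exact hu hPr
    refine mul_nonpos_of_nonneg_of_nonpos (hP0 u) ?_
    have h1 := G.form_simpleRoot_nonpos hN0 (hPN u hu)
    rw [map_sub, LinearMap.sub_apply, form_fundamentalWeight_simpleRoot hlor, if_neg hur] at h1
    linarith
  have hPv : G.form P v ≤ 0 := by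
    rw [form_comm, form_eq_sum]
    exact Finset.sum_nonpos fun u _ =>
      mul_nonpos_of_nonneg_of_nonpos (hP0 u) (hv.form_simpleRoot_neg u).le
  have hωpast : ω ∈ pastCone G.form v :=
    ⟨hr, by rw [form_comm, form_fundamentalWeight hlor]; exact (hv.pos r).le⟩
  have hPpast : -P ∈ pastCone G.form v := ⟨by simpa using hPP, by simpa using hPv⟩
  -- B(ω, P) = P_r = 0 makes −P a nonnegative multiple of ω. This excludes a positive coordinate of
  -- ω, where P and ω agree.
  obtain ⟨c, hc, hPω⟩ := hB.past_proportional hvv hωpast hPpast (fundamentalWeight_ne_zero hlor r)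
    (by rw [G.form_comm, form_fundamentalWeight hlor, Pi.neg_apply, hPr, neg_zero])
  intro u
  have h1 := congrFun hPω u
  simp only [Pi.neg_apply, Pi.smul_apply, smul_eq_mul] at h1
  have h2 : ω u ≤ P u := le_sup_left (a := ω) (b := 0) u
  have h3 : 0 ≤ P u := hP0 u
  by_contra! h4
  have h5 : 0 < ω u := h4
  nlinarith [mul_nonneg hc h5.le]

/-- For a space-like fundamental weight, the remaining fundamental weights project to causal
vectors on its orthogonal complement. -/
theorem form_projection_fundamentalWeight_nonpos (hlor : G.IsLorentzian) (hlev : G.IsOfLevel 2)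
    {s r : S} (hs : 0 < G.form (G.fundamentalWeight s) (G.fundamentalWeight s)) (hrs : r ≠ s)
    {z : S → ℝ} (hz : G.form z (G.fundamentalWeight s) = 0) (hzs : ∃ c : ℝ,
      z = G.fundamentalWeight r + c • G.fundamentalWeight s) : G.form z z ≤ 0 := by
  -- If `z` were space-like, removing from a time-like vector its components along ω_s and `z` would
  -- leave a time-like vector orthogonal to ω_s and ω_r, that is, with coordinates s and r zero.
  -- Level 2 forbids this.
  by_contra! hpos
  have hB := hlor.isLorentzForm
  obtain ⟨c, hc⟩ := hzs
  obtain ⟨v, hv⟩ := hlor.exists_form_neg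
  let e := v - (G.form v (G.fundamentalWeight s) /
    G.form (G.fundamentalWeight s) (G.fundamentalWeight s)) • G.fundamentalWeight s
  have he : G.form e e < 0 := hB.projection_neg hv hs
  have hes : G.form e (G.fundamentalWeight s) = 0 := IsLorentzForm.projection_orthogonal v hs
  let e' := e - (G.form e z / G.form z z) • z
  have he' : G.form e' e' < 0 := hB.projection_neg he hpos
  have hez : G.form e' z = 0 := IsLorentzForm.projection_orthogonal e hpos
  have hes' : G.form e' (G.fundamentalWeight s) = 0 := by
    simp only [e', map_sub, map_smul, LinearMap.sub_apply, LinearMap.smul_apply, hes, hz]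
    simp
  have her : G.form e' (G.fundamentalWeight r) = 0 := by
    rw [hc, map_add, map_smul, hes', smul_zero, add_zero] at hez
    exact hez
  rw [form_fundamentalWeight hlor] at hes' her
  exact he'.not_ge (hlev.1.form_nonneg hrs her hes')

/-- The Perron vector of a maximal proper parabolic subsystem that is not positive semidefinite. -/
theorem exists_perronVector_of_spaceLike (hlor : G.IsLorentzian) (hlev : G.IsOfLevel 2) {s : S}
    (hs : 0 < G.form (G.fundamentalWeight s) (G.fundamentalWeight s)) :
    ∃ y : S → ℝ, y s = 0 ∧ (∀ t, t ≠ s → 0 < y t) ∧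
      (∀ t, t ≠ s → G.form y (simpleRoot t) < 0) ∧ G.form y y < 0 := by
  have hB := hlor.isLorentzForm
  obtain ⟨v, hv⟩ := hlor.exists_form_neg
  have he := hB.projection_neg hv hs
  have hes := IsLorentzForm.projection_orthogonal v hs
  rw [form_fundamentalWeight hlor] at hes
  obtain ⟨y, μ, hy, hy0, hyJ, hμ, h⟩ := G.exists_perronFrobenius {s}ᶜ (x := _)
    (fun t ht => by rw [not_not.1 ht]; exact hes) he
  have hys : y s = 0 := hyJ s (by simp)
  have hyy : G.form y y < 0 := by
    have e : G.form y y = μ * ∑ t, y t * y t := by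
      rw [form_eq_sum, Finset.mul_sum]
      refine Finset.sum_congr rfl fun t _ => ?_
      by_cases hts : t = s
      · rw [hts, hys]; ring
      · rw [h t (by simpa using hts)]; ring
    rw [e]
    refine mul_neg_of_neg_of_pos hμ ?_
    obtain ⟨t, ht⟩ := Function.ne_iff.1 hy0
    exact Finset.sum_pos' (fun u _ => mul_self_nonneg _)
      ⟨t, Finset.mem_univ t, mul_self_pos.2 ht⟩
  -- A second zero coordinate would contradict level 2, so strict positivity needs no connectedness
  -- of the subsystem.
  have hpos : ∀ t, t ≠ s → 0 < y t := fun t hts => by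
    refine lt_of_le_of_ne (hy t) fun h0 => ?_
    exact hyy.not_ge (hlev.1.form_nonneg hts h0.symm hys)
  exact ⟨y, hys, hpos, fun t hts => by
    rw [h t (by simpa using hts)]; exact mul_neg_of_neg_of_pos hμ (hpos t hts), hyy⟩

/-! ### Future-directed light-like vectors -/

/-- Every height function induces the time orientation of `v`. If h(x) > 0 but B(x,v) ≥ 0, then
h(v)x − h(x)v is a time-like vector of the hyperplane h = 0, which in rank at least 3 then contains
a nonzero light-like vector. Conversely, the coordinates of `v` are the weights of a height, of
which B(·,v) is a negative multiple. -/
theorem futureDirected_iff (hlor : G.IsLorentzian) (hlev : G.IsOfLevel 2)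
    {v : S → ℝ} (hv : G.IsPerronVector v) {x : S → ℝ} (hx : x ∈ G.lightCone) :
    G.FutureDirected x ↔ G.form x v < 0 := by
  have hne : Nonempty S := Fintype.card_pos_iff.1 (by have := three_le_card hlev; omega)
  have hB := hlor.isLorentzForm
  have hvv := hv.form_self_neg
  have hx' : G.form x x = 0 := hx
  obtain ⟨μ, hμ, hμv⟩ := hv.eigen
  have hform : ∀ z, G.form z v = μ * ∑ s, v s * z s := fun z => by
    rw [form_comm, form_eq_sum, Finset.mul_sum]
    exact Finset.sum_congr rfl fun s _ => by rw [hμv]; ring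
  constructor
  · rintro ⟨c, ⟨hc, hc0⟩, hpos⟩
    by_contra! hxv
    let h : Module.Dual ℝ (S → ℝ) := ∑ s, c s • LinearMap.proj s
    have hh : ∀ z, h z = ∑ s, c s * z s := fun z => by simp [h, LinearMap.sum_apply]
    have hhv : 0 < h v := by
      rw [hh]
      exact Finset.sum_pos (fun s _ => mul_pos (hc s) (hv.pos s)) Finset.univ_nonempty
    have hhx : 0 < h x := by rw [hh]; exact hpos
    have hx0 : x ≠ 0 := by rintro rfl; simp at hhx
    let z := h v • x - h x • v
    have hhz : h z = 0 := by simp [z]; ring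
    have hzz : G.form z z < 0 := by
      simp only [z, map_sub, map_smul, LinearMap.sub_apply, LinearMap.smul_apply, smul_eq_mul, hx',
        G.form_comm v x]
      nlinarith [mul_nonneg (mul_pos hhv hhx).le hxv, mul_pos hhx hhx,
        mul_pos (mul_pos hhx hhx) (neg_pos.2 hvv)]
    obtain ⟨u, hu0, hhu, hzu⟩ := exists_ne_zero_of_two_functionals
      (by rw [Module.finrank_fintype_fun_eq_card]; exact three_le_card hlev) h (G.form z)
    obtain ⟨t, ht, hlight, -⟩ := hB.exists_lightlike hzz hu0 hzu
    have h0 := hc0 (z + t • u) hlight (by rw [← hh]; simp [hhz, hhu])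
    have h1 := congrArg (G.form z) h0
    rw [map_add, map_smul, hzu, smul_zero, add_zero, map_zero] at h1
    exact hzz.ne h1
  · intro hxv
    refine ⟨v, ⟨hv.pos, fun z hz h0 => ?_⟩, ?_⟩
    · have hz' : G.form z z = 0 := hz
      exact hB.eq_zero_of_orthogonal hvv (by rw [G.form_comm, hform, h0, mul_zero]) hz'.le
    · rw [hform] at hxv
      by_contra! h
      exact hxv.not_ge (mul_nonneg_of_nonpos_of_nonpos hμ.le h)

/-- Points of balls are represented by past vectors from here on; passing from the future-directed
−x to x reverses the inequality in `ball`. -/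
theorem mem_ball_iff (hlor : G.IsLorentzian) (hlev : G.IsOfLevel 2)
    {v : S → ℝ} (hv : G.IsPerronVector v) {ω x : S → ℝ} (h0 : x ≠ 0)
    (hx : x ∈ pastCone G.form v) :
    Projectivization.mk ℝ x h0 ∈ G.ball ω ↔ G.form x x = 0 ∧ 0 ≤ G.form ω x := by
  have hne : Nonempty S := Fintype.card_pos_iff.1 (by have := three_le_card hlev; omega)
  have hB := hlor.isLorentzForm
  have hxv := hB.past_pos hv.form_self_neg hx h0
  constructor
  · rintro ⟨y, ⟨hyQ, hyf, hy⟩, hy0, heq⟩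
    rw [futureDirected_iff hlor hlev hv hyQ] at hyf
    obtain ⟨a, rfl⟩ := (Projectivization.mk_eq_mk_iff' ℝ _ _ hy0 h0).1 heq
    have hyQ' : G.form (a • x) (a • x) = 0 := hyQ
    simp only [map_smul, LinearMap.smul_apply, smul_eq_mul] at hyQ' hyf hy
    have ha : a < 0 := by
      by_contra! ha
      exact hyf.not_ge (mul_nonneg ha hxv.le)
    refine ⟨by simpa [ha.ne] using hyQ', ?_⟩
    by_contra! h
    exact hy.not_gt (mul_pos_of_neg_of_neg ha h)
  · rintro ⟨hxx, h⟩
    have hQ : -x ∈ G.lightCone := by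
      change G.form (-x) (-x) = 0
      simpa using hxx
    refine ⟨-x, ⟨hQ, ?_, by simpa using h⟩, neg_ne_zero.2 h0, ?_⟩
    · rw [futureDirected_iff hlor hlev hv hQ]
      simpa using hxv
    · rw [Projectivization.mk_eq_mk_iff']
      exact ⟨-1, by simp⟩

/-- Every point of a ball is spanned by a past-directed light-like vector. -/
theorem exists_past_of_mem_ball (hlor : G.IsLorentzian) (hlev : G.IsOfLevel 2)
    {v : S → ℝ} (hv : G.IsPerronVector v) {ω : S → ℝ} {p : ℙ ℝ (S → ℝ)} (hp : p ∈ G.ball ω) :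
    ∃ x ∈ pastCone G.form v, ∃ h0 : x ≠ 0, Projectivization.mk ℝ x h0 = p := by
  obtain ⟨y, ⟨hyQ, hyf, hy⟩, hy0, rfl⟩ := hp
  have hyQ' : G.form y y = 0 := hyQ
  rw [futureDirected_iff hlor hlev hv hyQ] at hyf
  refine ⟨-y, ⟨by simpa using hyQ'.le, by simpa using hyf.le⟩, neg_ne_zero.2 hy0, ?_⟩
  rw [Projectivization.mk_eq_mk_iff']
  exact ⟨-1, by simp⟩

end GeometricCoxeterMatrix

/-! ### Closed convex cones -/

section ClosedCones

variable {E : Type*} [AddCommGroup E] [Module ℝ E]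

theorem PointedCone.hull_nonneg {X : Set E} (f : Module.Dual ℝ E) (h : ∀ x ∈ X, 0 ≤ f x) {x : E}
    (hx : x ∈ PointedCone.hull ℝ X) : 0 ≤ f x := by
  induction hx using Submodule.span_induction with
  | mem x hx => exact h x hx
  | zero => simp
  | add x y _ _ hx hy => rw [map_add]; exact add_nonneg hx hy
  | smul c x _ hx =>
    have : f (c • x) = (c : ℝ) * f x := map_smul f (c : ℝ) x
    rw [this]; exact mul_nonneg c.2 hx

theorem PointedCone.map_mem_hull {X : Set E} (L : E →ₗ[ℝ] E) (h : ∀ x ∈ X, L x ∈ X) {x : E}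
    (hx : x ∈ PointedCone.hull ℝ X) : L x ∈ PointedCone.hull ℝ X := by
  induction hx using Submodule.span_induction with
  | mem x hx => exact Submodule.subset_span (h x hx)
  | zero => simp
  | add x y _ _ hx hy => rw [map_add]; exact add_mem hx hy
  | smul c x _ hx =>
    have : L (c • x) = (c : ℝ) • L x := map_smul L (c : ℝ) x
    rw [this]; exact PointedCone.smul_mem _ c.2 hx

variable [TopologicalSpace E] [IsTopologicalAddGroup E] [ContinuousSMul ℝ E]

theorem PointedCone.closure_hull_nonneg {X : Set E} {f : Module.Dual ℝ E} (hf : Continuous f)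
    (h : ∀ x ∈ X, 0 ≤ f x) {x : E} (hx : x ∈ (PointedCone.hull ℝ X).closure) : 0 ≤ f x :=
  closure_minimal (s := (PointedCone.hull ℝ X : Set E)) (t := {x | 0 ≤ f x})
    (fun _ hy => PointedCone.hull_nonneg f h hy) (isClosed_le continuous_const hf) hx

theorem PointedCone.map_mem_closure_hull {X : Set E} {L : E →ₗ[ℝ] E} (hL : Continuous L)
    (h : ∀ x ∈ X, L x ∈ X) {x : E} (hx : x ∈ (PointedCone.hull ℝ X).closure) :
    L x ∈ (PointedCone.hull ℝ X).closure :=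
  map_mem_closure hL hx fun _ hy => PointedCone.map_mem_hull L h hy

theorem PointedCone.closure_hull_le {X : Set E} {T : PointedCone ℝ E} (hT : IsClosed (T : Set E))
    (h : X ⊆ T) : (PointedCone.hull ℝ X).closure ≤ T := fun _ hx =>
  closure_minimal (s := (PointedCone.hull ℝ X : Set E)) (t := (T : Set E))
    (Submodule.span_le.2 h) hT hx

theorem PointedCone.subset_closure_hull (X : Set E) :
    X ⊆ ((PointedCone.hull ℝ X).closure : Set E) := fun _ hx =>
  _root_.subset_closure (Submodule.subset_span hx)

end ClosedCones

theorem exists_pos_forall_add_mul_pos {ι : Type*} [Finite ι] (a b : ι → ℝ) (ha : ∀ i, 0 < a i) :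
    ∃ ε : ℝ, 0 < ε ∧ ∀ i, 0 < a i + ε * b i := by
  have h : ∀ᶠ ε in nhds (0 : ℝ), ∀ i, 0 < a i + ε * b i := by
    refine Filter.eventually_all.2 fun i => ?_
    have c : Continuous fun t : ℝ => a i + t * b i := by fun_prop
    exact (c.tendsto 0).eventually_const_lt (by simpa using ha i)
  obtain ⟨δ, hδ, h⟩ := Metric.eventually_nhds_iff.1 h
  refine ⟨δ / 2, by positivity, h ?_⟩
  rw [dist_zero_right, Real.norm_eq_abs, abs_of_pos (by positivity)]
  linarith

/-! ### Projection along a space-like vector -/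

section OrthogonalProjection

variable {E : Type*} [AddCommGroup E] [Module ℝ E]

/-- The projection onto the orthogonal complement of a vector. -/
def orthProj (B : LinearMap.BilinForm ℝ E) (x : E) : E →ₗ[ℝ] E :=
  LinearMap.id - ((B x x)⁻¹ • B.flip x).smulRight x

theorem orthProj_apply (B : LinearMap.BilinForm ℝ E) (x y : E) :
    orthProj B x y = y - (B y x / B x x) • x := by
  simp [orthProj, div_eq_inv_mul]

theorem eq_smul_add_orthProj (B : LinearMap.BilinForm ℝ E) (x y : E) :
    y = (B y x / B x x) • x + orthProj B x y := by
  rw [orthProj_apply]; abel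

theorem form_orthProj {B : LinearMap.BilinForm ℝ E} {x : E} (hx : 0 < B x x) (y : E) :
    B (orthProj B x y) x = 0 := by
  rw [orthProj_apply]
  exact IsLorentzForm.projection_orthogonal y hx

end OrthogonalProjection

namespace GeometricCoxeterMatrix

variable {S : Type*} {G : GeometricCoxeterMatrix S} [Fintype S] [DecidableEq S]

theorem form_le_zero_of_nonneg {x y : S → ℝ} (hx : ∀ s, G.form x (simpleRoot s) ≤ 0)
    (hy : 0 ≤ y) : G.form x y ≤ 0 := by
  rw [form_eq_sum]
  exact Finset.sum_nonpos fun s _ => mul_nonpos_of_nonneg_of_nonpos (hy s) (hx s)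

theorem exists_form_eq (hlor : G.IsLorentzian) (f : Module.Dual ℝ (S → ℝ)) :
    ∃ y, ∀ z, G.form y z = f z := by
  refine ⟨∑ s, f (simpleRoot s) • G.fundamentalWeight s, fun z => ?_⟩
  rw [form_eq_sum]
  conv_rhs => rw [eq_sum_smul_simpleRoot z, map_sum]
  refine Finset.sum_congr rfl fun t _ => ?_
  simp [LinearMap.sum_apply, form_fundamentalWeight_simpleRoot hlor]

variable {W : Type*} [Group W] (cs : CoxeterSystem G.M W)

/-! ### Weights and the group action -/

theorem fundamentalWeight_mem_weights (s : S) : G.fundamentalWeight s ∈ weights cs :=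
  ⟨1, s, (geometricRep_one_apply cs _).symm⟩

theorem geometricRep_mem_weights (w : W) {ω : S → ℝ} (h : ω ∈ weights cs) :
    geometricRep cs w ω ∈ weights cs := by
  obtain ⟨w', s, rfl⟩ := h
  exact ⟨w * w', s, (geometricRep_mul_apply cs _ _ _).symm⟩

theorem geometricRep_mem_spaceLikeWeights (w : W) {ω : S → ℝ} (h : ω ∈ spaceLikeWeights cs) :
    geometricRep cs w ω ∈ spaceLikeWeights cs :=
  ⟨geometricRep_mem_weights cs w h.1, by rw [form_geometricRep]; exact h.2⟩

theorem geometricRep_mem_titsCone (w : W) {x : S → ℝ} (h : x ∈ titsCone cs) :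
    geometricRep cs w x ∈ titsCone cs :=
  PointedCone.map_mem_closure_hull (L := (geometricRep cs w).toLinearMap)
    (LinearMap.continuous_of_finiteDimensional _)
    (fun _ hx => geometricRep_mem_weights cs w hx) h

theorem mem_titsCone_of_mem_weights {ω : S → ℝ} (h : ω ∈ weights cs) : ω ∈ titsCone cs :=
  PointedCone.subset_closure_hull _ h

/-- Since w ω_s ≤ ω_s coordinatewise and `y` pairs nonpositively with nonnegative vectors, B(y, w
ω_s) ≥ B(y, ω_s) = y_s. -/
theorem form_nonneg_of_mem_weights (hlor : G.IsLorentzian) {y : S → ℝ} (hy : 0 ≤ y)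
    (hyD : ∀ s, G.form y (simpleRoot s) ≤ 0) {ω : S → ℝ} (hω : ω ∈ weights cs) :
    0 ≤ G.form y ω := by
  obtain ⟨w, s, rfl⟩ := hω
  have h1 := geometricRep_le_self cs (x := G.fundamentalWeight s) (fun t => by
    rw [form_fundamentalWeight_simpleRoot hlor]; split_ifs <;> norm_num) w
  have h2 := form_le_zero_of_nonneg hyD (sub_nonneg.2 h1)
  rw [map_sub, form_fundamentalWeight hlor] at h2
  have h3 : 0 ≤ y s := hy s
  linarith

theorem form_nonneg_of_mem_titsCone (hlor : G.IsLorentzian) {y : S → ℝ} (hy : 0 ≤ y)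
    (hyD : ∀ s, G.form y (simpleRoot s) ≤ 0) {x : S → ℝ} (hx : x ∈ titsCone cs) :
    0 ≤ G.form y x :=
  PointedCone.closure_hull_nonneg (G.continuous_form_right y)
    (fun _ h => form_nonneg_of_mem_weights cs hlor hy hyD h) hx

/-- The Tits cone is strictly on the past side of a Perron vector. -/
theorem titsCone_form_pos (hlor : G.IsLorentzian) {v : S → ℝ} (hv : G.IsPerronVector v)
    {x : S → ℝ} (hx : x ∈ titsCone cs) (h0 : x ≠ 0) : 0 < G.form x v := by
  -- The sign conditions that make a vector nonnegative on the Tits cone hold strictly at `v`, so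
  -- they survive a small move in any direction `z`.
  have hle : ∀ z : S → ℝ, ∃ ε : ℝ, 0 < ε ∧ 0 ≤ G.form x v + ε * G.form x z := fun z => by
    obtain ⟨ε, hε, h⟩ := exists_pos_forall_add_mul_pos
      (Sum.elim v fun s => -G.form v (simpleRoot s))
      (Sum.elim z fun s => -G.form z (simpleRoot s)) (by
        rintro (s | s)
        · exact hv.pos s
        · simpa using hv.form_simpleRoot_neg s)
    refine ⟨ε, hε, ?_⟩
    have := form_nonneg_of_mem_titsCone cs hlor (y := v + ε • z) (fun s => (h (Sum.inl s)).le)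
      (fun s => by
        have := h (Sum.inr s)
        simp only [Sum.elim_inr] at this
        simp only [map_add, map_smul, LinearMap.add_apply, LinearMap.smul_apply, smul_eq_mul]
        linarith) hx
    rw [form_comm] at this
    simpa using this
  by_contra! hneg
  obtain ⟨z, hz⟩ : ∃ z, G.form x z < 0 := by
    obtain ⟨u, hu⟩ := hlor.exists_form_neg
    by_contra! h
    refine h0 (hlor.isLorentzForm.eq_zero_of_forall hu fun y => le_antisymm ?_ (h y))
    have := h (-y)
    simpa using this
  obtain ⟨ε, hε, h⟩ := hle z
  nlinarith

/-- A simple reflection keeps the time orientation because B(σ_s v, v) = B(v,v) − 2 B(v,α_s)² < 0.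
-/
theorem geometricRep_mem_pastCone (hlor : G.IsLorentzian) [Nonempty S] {v : S → ℝ}
    (hv : G.IsPerronVector v) (w : W) {x : S → ℝ} (hx : x ∈ pastCone G.form v) :
    geometricRep cs w x ∈ pastCone G.form v := by
  have hB := hlor.isLorentzForm
  have hvv := hv.form_self_neg
  induction w using cs.simple_induction_left with
  | one => simpa [geometricRep_one_apply] using hx
  | mul_simple_left w s ih =>
    rw [geometricRep_mul_apply, geometricRep_simple]
    set y := geometricRep cs w x
    have e : G.form (G.simpleReflection s v) v < 0 := by
      rw [simpleReflection_apply, map_sub, map_smul, LinearMap.sub_apply, LinearMap.smul_apply,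
        smul_eq_mul, G.form_comm (simpleRoot s) v]
      nlinarith [mul_self_nonneg (G.form v (simpleRoot s))]
    refine hB.mem_past_of_form_nonneg hvv (u := G.simpleReflection s v) ?_ ?_ e.le ?_
    · rw [form_simpleReflection]; exact ih.1
    · rw [form_simpleReflection]; exact hvv
    · rw [form_simpleReflection]; exact ih.2

/-! ### Projection of the Tits cone from a space-like weight -/

/-- The reflections σ_t with t ≠ s fix ω = ω_s. The projected Tits cone lies in a closed cone `X`
orthogonal to ω and stable under them. Every z in `X` has the norm of some z' in `X` with B(z', α_t)
≥ 0 for t ≠ s. Such a z' is a nonnegative combination of the projections of the ω_t, which are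
causal by level 2. -/
theorem orthProj_fundamentalWeight_mem_pastCone (hlor : G.IsLorentzian) (hlev : G.IsOfLevel 2)
    {v : S → ℝ} (hv : G.IsPerronVector v) {s : S}
    (hs : 0 < G.form (G.fundamentalWeight s) (G.fundamentalWeight s)) {x : S → ℝ}
    (hx : x ∈ titsCone cs) : orthProj G.form (G.fundamentalWeight s) x ∈ pastCone G.form v := by
  have hne : Nonempty S := ⟨s⟩
  have hB := hlor.isLorentzForm
  have hvv := hv.form_self_neg
  set ω := G.fundamentalWeight s with hω
  obtain ⟨y₀, hy₀s, hy₀, hy₀D, hy₀y₀⟩ := exists_perronVector_of_spaceLike hlor hlev hs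
  have hy₀0 : 0 ≤ y₀ := fun t => by
    by_cases ht : t = s
    · rw [ht, hy₀s]; rfl
    · exact (hy₀ t ht).le
  have hy₀v : G.form y₀ v ≤ 0 := by
    rw [form_comm]
    exact form_le_zero_of_nonneg (fun t => (hv.form_simpleRoot_neg t).le) hy₀0
  -- `X` is cut out by functionals already known to be nonnegative on the Tits cone, so closedness
  -- and invariance come for free. Quantifying over the stabiliser of ω avoids parabolic subgroups.
  -- The sign condition at t = s is automatic from y ≥ 0 and y_s = 0.
  let X : Set (S → ℝ) := {z | G.form z ω = 0 ∧ ∀ w : W, geometricRep cs w ω = ω →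
    ∀ y : S → ℝ, 0 ≤ y → (∀ t, G.form y (simpleRoot t) ≤ 0) → y s = 0 →
      0 ≤ G.form z (geometricRep cs w y)}
  have hXclosed : IsClosed X := by
    have e : X = {z | G.form z ω = 0} ∩ ⋂ (w : W) (_ : geometricRep cs w ω = ω) (y : S → ℝ)
        (_ : 0 ≤ y) (_ : ∀ t, G.form y (simpleRoot t) ≤ 0) (_ : y s = 0),
          {z | 0 ≤ G.form z (geometricRep cs w y)} := by
      ext z; simp [X]
    rw [e]
    refine (isClosed_eq (G.continuous_form_left ω) continuous_const).inter ?_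
    repeat refine isClosed_iInter fun _ => ?_
    exact isClosed_le continuous_const (G.continuous_form_left _)
  have hXsmul : ∀ c : ℝ, 0 ≤ c → ∀ z ∈ X, c • z ∈ X := fun c hc z hz => by
    refine ⟨by simp [hz.1], fun w hw y h1 h2 h3 => ?_⟩
    rw [map_smul, LinearMap.smul_apply, smul_eq_mul]
    exact mul_nonneg hc (hz.2 w hw y h1 h2 h3)
  have hfix : ∀ t, t ≠ s → geometricRep cs (cs.simple t) ω = ω := fun t ht => by
    rw [geometricRep_simple, simpleReflection_apply, form_fundamentalWeight_simpleRoot hlor,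
      if_neg ht]
    simp
  have hXinv : ∀ t, t ≠ s → ∀ z ∈ X, G.simpleReflection t z ∈ X := fun t ht z hz => by
    rw [← geometricRep_simple cs]
    refine ⟨?_, fun w hw y h1 h2 h3 => ?_⟩
    · rw [← hfix t ht, form_geometricRep]; exact hz.1
    · rw [form_geometricRep_left, cs.inv_simple, ← geometricRep_mul_apply]
      exact hz.2 _ (by rw [geometricRep_mul_apply, hw, hfix t ht]) y h1 h2 h3
  have hXone : ∀ z ∈ X, ∀ y : S → ℝ, 0 ≤ y → (∀ t, t ≠ s → G.form y (simpleRoot t) ≤ 0) →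
      y s = 0 → 0 ≤ G.form z y := fun z hz y h1 h2 h3 => by
    have := hz.2 1 (geometricRep_one_apply cs ω) y h1 (fun t => by
      by_cases ht : t = s
      · exact G.form_simpleRoot_nonpos h1 (by rw [ht, h3])
      · exact h2 t ht) h3
    rwa [geometricRep_one_apply] at this
  have hXy₀ : ∀ z ∈ X, 0 ≤ G.form z y₀ := fun z hz =>
    hXone z hz y₀ hy₀0 (fun t ht => (hy₀D t ht).le) hy₀s
  -- `y₀` satisfies the conditions strictly away from s, so it may be moved along ±α_t. If B(z, y₀)
  -- = 0, then B(z, α_t) = 0 for all t ≠ s, so z is a multiple of ω orthogonal to ω.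
  have hXpos : ∀ z ∈ X, z ≠ 0 → 0 < G.form y₀ z := fun z hz hz0 => by
    rw [form_comm]
    refine lt_of_le_of_ne (hXy₀ z hz) fun h => ?_
    obtain ⟨t, hts, ht⟩ : ∃ t, t ≠ s ∧ G.form z (simpleRoot t) ≠ 0 := by
      by_contra! hall
      have e := eq_sum_smul_fundamentalWeight hlor z
      rw [Finset.sum_eq_single s (fun t _ ht => by rw [hall t ht, zero_smul]) (by simp)] at e
      have h1 := hz.1
      rw [e, map_smul, LinearMap.smul_apply, smul_eq_mul] at h1
      rw [(mul_eq_zero.1 h1).resolve_right hs.ne', zero_smul] at e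
      exact hz0 e
    let b := G.form z (simpleRoot t)
    obtain ⟨ε, hε, hpos⟩ := exists_pos_forall_add_mul_pos (ι := {t // t ≠ s} ⊕ {t // t ≠ s})
      (Sum.elim (fun u => y₀ u) fun u => -G.form y₀ (simpleRoot u.1))
      (Sum.elim (fun u => (-b) * simpleRoot t u.1)
        fun u => -(-b * G.form (simpleRoot t) (simpleRoot u.1))) (by
        rintro (⟨u, hu⟩ | ⟨u, hu⟩)
        · exact hy₀ u hu
        · simpa using hy₀D u hu)
    have hst : simpleRoot t s = 0 := by simp [simpleRoot, Ne.symm hts]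
    have h1 := hXone z hz (y₀ + ε • (-b) • simpleRoot t) (fun u => by
        by_cases hu : u = s
        · simp [hu, hy₀s, hst]
        · have := hpos (Sum.inl ⟨u, hu⟩)
          simp only [Sum.elim_inl] at this
          simp only [Pi.zero_apply, Pi.add_apply, Pi.smul_apply, smul_eq_mul]
          exact this.le) (fun u hu => by
        have := hpos (Sum.inr ⟨u, hu⟩)
        simp only [Sum.elim_inr] at this
        simp only [map_add, map_smul, LinearMap.add_apply, LinearMap.smul_apply, smul_eq_mul]
        linarith) (by simp [hy₀s, hst])
    rw [map_add, map_smul, map_smul, ← h, smul_eq_mul, smul_eq_mul, zero_add] at h1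
    have h2 : 0 < b * b := mul_self_pos.2 ht
    have h3 : ε * (-b * G.form z (simpleRoot t)) = -(ε * (b * b)) := by ring
    rw [h3] at h1
    linarith [mul_pos hε h2]
  have hpast : ∀ z ∈ X, z ∈ pastCone G.form v := fun z hz => by
    obtain ⟨z', hz', hq, hmin⟩ := exists_isMinOn_level hXclosed hXsmul (G.form y₀) hXpos
      G.continuous_form_self hz
    -- If B(z', α_t) < 0, reflecting in α_t would lower B(y₀, ·), since B(y₀, α_t) < 0.
    have hz'D : ∀ t, t ≠ s → 0 ≤ G.form z' (simpleRoot t) := fun t ht => by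
      have h := hmin _ (hXinv t ht z' hz') (by rw [form_simpleReflection, hq])
      rw [simpleReflection_apply, map_sub, map_smul, smul_eq_mul] at h
      by_contra! hlt
      nlinarith [mul_pos_of_neg_of_neg hlt (hy₀D t ht)]
    have hz'past : z' ∈ pastCone G.form v := by
      have e : z' = ∑ t, G.form z' (simpleRoot t) • orthProj G.form ω (G.fundamentalWeight t) := by
        have e1 : orthProj G.form ω z' = z' := by rw [orthProj_apply, hz'.1]; simp
        conv_lhs => rw [← e1, eq_sum_smul_fundamentalWeight hlor z', map_sum]
        simp only [map_smul]
      rw [e]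
      refine hB.past_sum hvv _ _ fun t _ => ?_
      by_cases ht : t = s
      · have : orthProj G.form ω (G.fundamentalWeight t) = 0 := by
          rw [ht, orthProj_apply, div_self hs.ne', one_smul, sub_self]
        rw [this, smul_zero]
        simp [pastCone]
      refine IsLorentzForm.past_smul ?_ (hz'D t ht)
      refine hB.mem_past_of_form_nonneg hvv (u := y₀) ?_ hy₀y₀ hy₀v ?_
      · refine form_projection_fundamentalWeight_nonpos hlor hlev hs ht (form_orthProj hs _)
          ⟨-(G.form (G.fundamentalWeight t) ω / G.form ω ω), ?_⟩
        rw [orthProj_apply, neg_smul, sub_eq_add_neg]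
      · have hy₀ω : G.form y₀ ω = 0 := by rw [form_fundamentalWeight hlor, hy₀s]
        rw [orthProj_apply, form_comm, map_sub, map_smul, hy₀ω, smul_zero, sub_zero,
          form_fundamentalWeight hlor]
        exact (hy₀ t ht).le
    refine hB.mem_past_of_form_nonneg hvv (u := y₀) ?_ hy₀y₀ hy₀v (hXy₀ z hz)
    rw [← hq]
    exact hz'past.1
  refine hpast _ ⟨form_orthProj hs x, fun w hw y h1 h2 h3 => ?_⟩
  have e : G.form ω (geometricRep cs w y) = 0 := by
    conv_lhs => rw [← hw]
    rw [form_geometricRep, form_comm, form_fundamentalWeight hlor, h3]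
  rw [orthProj_apply, map_sub, map_smul, LinearMap.sub_apply, LinearMap.smul_apply, e, smul_zero,
    sub_zero, form_comm, form_geometricRep_left]
  exact form_nonneg_of_mem_titsCone cs hlor h1 h2 (geometricRep_mem_titsCone cs _ hx)

theorem orthProj_mem_pastCone (hlor : G.IsLorentzian) (hlev : G.IsOfLevel 2)
    {v : S → ℝ} (hv : G.IsPerronVector v) {ω : S → ℝ} (hω : ω ∈ spaceLikeWeights cs) {x : S → ℝ}
    (hx : x ∈ titsCone cs) : orthProj G.form ω x ∈ pastCone G.form v := by
  obtain ⟨⟨w, s, rfl⟩, hpos⟩ := hω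
  have hne : Nonempty S := ⟨s⟩
  rw [form_geometricRep] at hpos
  have h := geometricRep_mem_pastCone cs hlor hv w
    (orthProj_fundamentalWeight_mem_pastCone cs hlor hlev hv hpos
      (geometricRep_mem_titsCone cs w⁻¹ hx))
  convert h using 1
  rw [orthProj_apply, orthProj_apply, map_sub, map_smul, ← geometricRep_mul_apply, mul_inv_cancel,
    geometricRep_one_apply, form_geometricRep, form_geometricRep_left, inv_inv]

end GeometricCoxeterMatrix

namespace GeometricCoxeterMatrix

variable {S : Type*} {G : GeometricCoxeterMatrix S} [Fintype S] [DecidableEq S]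
  {W : Type*} [Group W] (cs : CoxeterSystem G.M W)

/-! ### The Tits cone is spanned by the space-like weights -/

theorem simpleReflection_mem_hull (t : S) {x : S → ℝ}
    (hx : x ∈ PointedCone.hull ℝ (spaceLikeWeights cs)) :
    G.simpleReflection t x ∈ PointedCone.hull ℝ (spaceLikeWeights cs) := by
  rw [← geometricRep_simple cs]
  exact PointedCone.map_mem_hull (geometricRep cs (cs.simple t)).toLinearMap
    (fun _ h => geometricRep_mem_spaceLikeWeights cs _ h) hx

/-- Start from a space-like ω_s and move along the Coxeter graph: if x is dominant and strictly
positive at a, then x + ½ σ_a x is dominant and strictly positive at the neighbours of a. Any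
coefficient strictly between 0 and 1 would do. -/
theorem exists_mem_hull_form_pos (hirr : G.IsIrreducible) (hlor : G.IsLorentzian)
    (hlev : G.IsOfLevel 2) :
    ∃ x ∈ PointedCone.hull ℝ (spaceLikeWeights cs), ∀ t, 0 < G.form x (simpleRoot t) := by
  obtain ⟨s, hs⟩ := exists_spaceLike_fundamentalWeight hlor hlev
  have key : ∀ t, ∃ x ∈ PointedCone.hull ℝ (spaceLikeWeights cs),
      (∀ u, 0 ≤ G.form x (simpleRoot u)) ∧ 0 < G.form x (simpleRoot t) := fun t => by
    have h0 : ∃ x ∈ PointedCone.hull ℝ (spaceLikeWeights cs),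
        (∀ u, 0 ≤ G.form x (simpleRoot u)) ∧ 0 < G.form x (simpleRoot s) :=
      ⟨G.fundamentalWeight s, Submodule.subset_span ⟨fundamentalWeight_mem_weights cs s, hs⟩,
        fun u => by rw [form_fundamentalWeight_simpleRoot hlor]; split_ifs <;> norm_num,
        by rw [form_fundamentalWeight_simpleRoot hlor, if_pos rfl]; exact one_pos⟩
    obtain ⟨p⟩ := hirr.preconnected s t
    clear hs
    induction p with
    | nil => exact h0
    | @cons a b _ hadj _ ih =>
      refine ih ?_
      obtain ⟨x, hx, hxD, hxa⟩ := h0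
      have hform : ∀ u, G.form (x + (1 / 2 : ℝ) • G.simpleReflection a x) (simpleRoot u) =
          3 / 2 * G.form x (simpleRoot u) - G.form x (simpleRoot a) * G.gram a u := fun u => by
        rw [simpleReflection_apply]
        simp only [map_add, map_sub, map_smul, LinearMap.add_apply, LinearMap.sub_apply,
          LinearMap.smul_apply, smul_eq_mul, form_simpleRoot]
        ring
      refine ⟨x + (1 / 2 : ℝ) • G.simpleReflection a x, add_mem hx
        (PointedCone.smul_mem _ (by norm_num) (simpleReflection_mem_hull cs a hx)),
        fun u => ?_, ?_⟩
      · rw [hform]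
        by_cases hu : a = u
        · subst hu
          rw [gram_self]; linarith
        · nlinarith [hxD u, mul_nonneg hxa.le (neg_nonneg.2 (G.gram_nonpos hu))]
      · rw [hform]
        nlinarith [hxD b, mul_pos hxa (neg_pos.2 (G.gram_neg_of_adj hadj))]
  choose x hx hxD hxt using key
  refine ⟨∑ t, x t, sum_mem fun t _ => hx t, fun t => ?_⟩
  rw [map_sum, LinearMap.sum_apply]
  exact Finset.sum_pos' (fun u _ => hxD u t) ⟨t, Finset.mem_univ t, hxt t⟩

/-- This expresses that the space-like weights span V. Start from α_s = ½(ω_s − σ_s ω_s) and pass to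
neighbours by σ_u α_t − α_t = −2 B_tu α_u. -/
theorem exists_simpleRoot_eq_sub (hirr : G.IsIrreducible) (hlor : G.IsLorentzian)
    (hlev : G.IsOfLevel 2) (t : S) :
    ∃ a ∈ PointedCone.hull ℝ (spaceLikeWeights cs),
      ∃ b ∈ PointedCone.hull ℝ (spaceLikeWeights cs), simpleRoot t = a - b := by
  obtain ⟨s, hs⟩ := exists_spaceLike_fundamentalWeight hlor hlev
  have h0 : ∃ a ∈ PointedCone.hull ℝ (spaceLikeWeights cs),
      ∃ b ∈ PointedCone.hull ℝ (spaceLikeWeights cs), simpleRoot s = a - b := by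
    have hω : G.fundamentalWeight s ∈ PointedCone.hull ℝ (spaceLikeWeights cs) :=
      Submodule.subset_span ⟨fundamentalWeight_mem_weights cs s, hs⟩
    refine ⟨_, PointedCone.smul_mem _ (by norm_num : (0 : ℝ) ≤ 1 / 2) hω, _,
      PointedCone.smul_mem _ (by norm_num : (0 : ℝ) ≤ 1 / 2)
        (simpleReflection_mem_hull cs s hω), ?_⟩
    rw [simpleReflection_apply, form_fundamentalWeight_simpleRoot hlor, if_pos rfl]
    module
  obtain ⟨p⟩ := hirr.preconnected s t
  clear hs
  induction p with
  | nil => exact h0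
  | @cons t u _ hadj _ ih =>
    refine ih ?_
    obtain ⟨a, ha, b, hb, hab⟩ := h0
    have hg := G.gram_neg_of_adj hadj
    have hk : 0 ≤ (-(2 * G.gram t u))⁻¹ := inv_nonneg.2 (by linarith)
    refine ⟨_, PointedCone.smul_mem _ hk (add_mem (simpleReflection_mem_hull cs u ha) hb), _,
      PointedCone.smul_mem _ hk (add_mem (simpleReflection_mem_hull cs u hb) ha), ?_⟩
    have e : G.simpleReflection u a + b - (G.simpleReflection u b + a) =
        (-(2 * G.gram t u)) • simpleRoot u := by
      have e1 : G.simpleReflection u a + b - (G.simpleReflection u b + a) =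
          G.simpleReflection u (a - b) - (a - b) := by rw [map_sub]; abel
      rw [e1, ← hab, simpleReflection_apply, form_simpleRoot]
      module
    rw [← smul_sub, e, smul_smul, inv_mul_cancel₀ (by linarith), one_smul]

/-- Take the sum of all the vectors whose differences are the simple roots. If its pairing with y
vanishes, so does each summand's, and y is orthogonal to every simple root. -/
theorem exists_mem_hull_form_pos_of_dual (hirr : G.IsIrreducible) (hlor : G.IsLorentzian)
    (hlev : G.IsOfLevel 2) :
    ∃ x ∈ PointedCone.hull ℝ (spaceLikeWeights cs), ∀ y : S → ℝ,
      (∀ ω ∈ spaceLikeWeights cs, 0 ≤ G.form y ω) → y ≠ 0 → 0 < G.form x y := by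
  choose a ha b hb hab using exists_simpleRoot_eq_sub cs hirr hlor hlev
  refine ⟨∑ t, (a t + b t), sum_mem fun t _ => add_mem (ha t) (hb t), fun y hy hy0 => ?_⟩
  have hnn : ∀ x ∈ PointedCone.hull ℝ (spaceLikeWeights cs), 0 ≤ G.form x y := fun x hx => by
    rw [form_comm]; exact PointedCone.hull_nonneg (G.form y) hy hx
  obtain ⟨t, ht⟩ : ∃ t, G.form (simpleRoot t) y ≠ 0 := by
    by_contra! h
    obtain ⟨u, hu⟩ := hlor.exists_form_neg
    refine hy0 (hlor.isLorentzForm.eq_zero_of_forall hu fun z => ?_)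
    rw [form_eq_sum]
    exact Finset.sum_eq_zero fun s _ => by rw [form_comm, h, mul_zero]
  rw [map_sum, LinearMap.sum_apply]
  refine Finset.sum_pos' (fun u _ => hnn _ (add_mem (ha u) (hb u))) ⟨t, Finset.mem_univ t, ?_⟩
  have h1 := hnn _ (ha t)
  have h2 := hnn _ (hb t)
  rw [map_add, LinearMap.add_apply]
  refine lt_of_le_of_ne (add_nonneg h1 h2) fun h => ht ?_
  rw [hab, map_sub, LinearMap.sub_apply]
  linarith

/-- The dual of the cone of the space-like weights consists of future causal vectors. -/
theorem neg_mem_pastCone_of_dual (hirr : G.IsIrreducible) (hlor : G.IsLorentzian)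
    (hlev : G.IsOfLevel 2) {v : S → ℝ} (hv : G.IsPerronVector v) {y : S → ℝ}
    (hy : ∀ ω ∈ spaceLikeWeights cs, 0 ≤ G.form y ω) : -y ∈ pastCone G.form v := by
  obtain ⟨s, hs⟩ := exists_spaceLike_fundamentalWeight hlor hlev
  have hne : Nonempty S := ⟨s⟩
  have hB := hlor.isLorentzForm
  have hvv := hv.form_self_neg
  let Y : Set (S → ℝ) := {y | ∀ ω ∈ spaceLikeWeights cs, 0 ≤ G.form y ω}
  have hYclosed : IsClosed Y := by
    have e : Y = ⋂ ω ∈ spaceLikeWeights cs, {y | 0 ≤ G.form y ω} := by ext z; simp [Y]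
    rw [e]
    exact isClosed_biInter fun ω _ => isClosed_le continuous_const (G.continuous_form_left ω)
  have hYsmul : ∀ c : ℝ, 0 ≤ c → ∀ z ∈ Y, c • z ∈ Y := fun c hc z hz ω hω => by
    rw [map_smul, LinearMap.smul_apply, smul_eq_mul]
    exact mul_nonneg hc (hz ω hω)
  have hYinv : ∀ t, ∀ z ∈ Y, G.simpleReflection t z ∈ Y := fun t z hz ω hω => by
    rw [← geometricRep_simple cs, form_geometricRep_left]
    exact hz _ (geometricRep_mem_spaceLikeWeights cs _ hω)
  obtain ⟨x₀, hx₀, hx₀D⟩ := exists_mem_hull_form_pos cs hirr hlor hlev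
  obtain ⟨x₁, hx₁, hx₁Y⟩ := exists_mem_hull_form_pos_of_dual cs hirr hlor hlev
  -- `x₀ + ε • x₁` is strictly dominant, like `x₀`, and strictly positive on `Y` away from 0, like
  -- `x₁`. The first drives the minimiser into the negative chamber, the second makes a minimum
  -- exist.
  obtain ⟨ε, hε, hxD⟩ := exists_pos_forall_add_mul_pos (fun t => G.form x₀ (simpleRoot t))
    (fun t => G.form x₁ (simpleRoot t)) hx₀D
  have hpos : ∀ z ∈ Y, z ≠ 0 → 0 < G.form (x₀ + ε • x₁) z := fun z hz hz0 => by
    have h1 : 0 ≤ G.form x₀ z := by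
      rw [form_comm]; exact PointedCone.hull_nonneg (G.form z) hz hx₀
    have h2 := mul_pos hε (hx₁Y z hz hz0)
    simp only [map_add, map_smul, LinearMap.add_apply, LinearMap.smul_apply, smul_eq_mul]
    linarith
  have hcausal : ∀ z ∈ Y, G.form z z ≤ 0 := fun z hz => by
    obtain ⟨z', hz', hq, hmin⟩ := exists_isMinOn_level hYclosed hYsmul (G.form (x₀ + ε • x₁)) hpos
      G.continuous_form_self hz
    have hz'D : ∀ t, G.form z' (simpleRoot t) ≤ 0 := fun t => by
      have h := hmin _ (hYinv t z' hz') (by rw [form_simpleReflection, hq])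
      rw [simpleReflection_apply, map_sub, map_smul, smul_eq_mul] at h
      have h1 := hxD t
      have h2 : G.form (x₀ + ε • x₁) (simpleRoot t) =
        G.form x₀ (simpleRoot t) + ε * G.form x₁ (simpleRoot t) := by simp
      rw [← h2] at h1
      by_contra! hlt
      nlinarith [mul_pos hlt h1]
    -- The coordinate z'_r is B(z', ω_r). For space-like ω_r it is nonnegative by membership in `Y`;
    -- otherwise ω_r ≤ 0 and z' pairs nonpositively with nonnegative vectors.
    have hz'0 : 0 ≤ z' := fun r => by
      change 0 ≤ z' r
      rw [← form_fundamentalWeight hlor z' r]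
      by_cases hr : 0 < G.form (G.fundamentalWeight r) (G.fundamentalWeight r)
      · exact hz' _ ⟨fundamentalWeight_mem_weights cs r, hr⟩
      · have h1 := fundamentalWeight_nonpos hlor hv (not_lt.1 hr)
        have h2 := form_le_zero_of_nonneg hz'D (neg_nonneg.2 h1)
        simpa using h2
    rw [← hq]
    exact form_le_zero_of_nonneg hz'D hz'0
  refine ⟨by simpa using hcausal y hy, ?_⟩
  rw [map_neg, LinearMap.neg_apply, neg_nonneg]
  by_contra! hyv
  -- Chosen so that y + a v is orthogonal to `v`. As this vector lies in `Y` it is causal, hence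
  -- zero, and y = −a v would be negative on a space-like fundamental weight.
  set a := -(G.form y v / G.form v v) with ha
  have ha0 : 0 < a := by
    rw [ha, ← div_neg]; exact div_pos hyv (by linarith)
  have hav : y + a • v ∈ Y := fun ω hω => by
    simp only [map_add, map_smul, LinearMap.add_apply, LinearMap.smul_apply, smul_eq_mul]
    exact add_nonneg (hy ω hω) (mul_nonneg ha0.le (form_nonneg_of_mem_weights cs hlor
      (fun t => (hv.pos t).le) (fun t => (hv.form_simpleRoot_neg t).le) hω.1))
  have h0 : y + a • v = 0 := hB.eq_zero_of_orthogonal hvv (by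
    rw [map_add, map_smul, smul_eq_mul, G.form_comm v y, ha, neg_mul,
      div_mul_cancel₀ _ hvv.ne, add_neg_cancel]) (hcausal _ hav)
  have h1 := hy _ ⟨fundamentalWeight_mem_weights cs s, hs⟩
  rw [form_fundamentalWeight hlor, eq_neg_of_add_eq_zero_left h0] at h1
  have h2 := mul_pos ha0 (hv.pos s)
  simp only [Pi.neg_apply, Pi.smul_apply, smul_eq_mul] at h1
  linarith

/-- Separate a point from the closed cone: the separating functional is B(y, ·) with −y past, and
this is nonnegative on past vectors. -/
theorem pastCone_subset_closure_hull (hirr : G.IsIrreducible) (hlor : G.IsLorentzian)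
    (hlev : G.IsOfLevel 2) {v : S → ℝ} (hv : G.IsPerronVector v) :
    pastCone G.form v ⊆ (PointedCone.hull ℝ (spaceLikeWeights cs)).closure := by
  have hne : Nonempty S := Fintype.card_pos_iff.1 (by have := three_le_card hlev; omega)
  intro x hx
  by_contra hxT
  let T : ProperCone ℝ (S → ℝ) := ⟨(PointedCone.hull ℝ (spaceLikeWeights cs)).closure,
    isClosed_closure⟩
  obtain ⟨f, hf, hfx⟩ := T.hyperplane_separation_point (x₀ := x) hxT
  obtain ⟨y, hy⟩ := exists_form_eq hlor (f : (S → ℝ) →ₗ[ℝ] ℝ)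
  have h1 := neg_mem_pastCone_of_dual cs hirr hlor hlev hv (y := y) fun ω hω => by
    rw [hy]; exact hf ω (PointedCone.subset_closure_hull _ hω)
  have h2 := hlor.isLorentzForm.past_form_nonpos hv.form_self_neg h1 hx
  rw [map_neg, LinearMap.neg_apply, hy, neg_nonpos] at h2
  exact hfx.not_ge h2

theorem titsCone_eq_closure_hull (hirr : G.IsIrreducible) (hlor : G.IsLorentzian)
    (hlev : G.IsOfLevel 2) :
    titsCone cs = (PointedCone.hull ℝ (spaceLikeWeights cs)).closure := by
  obtain ⟨v, hv⟩ := exists_isPerronVector hirr hlor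
  apply le_antisymm
  · refine PointedCone.closure_hull_le isClosed_closure fun ω hω => ?_
    by_cases h : 0 < G.form ω ω
    · exact PointedCone.subset_closure_hull _ ⟨hω, h⟩
    · refine pastCone_subset_closure_hull cs hirr hlor hlev hv ?_
      obtain ⟨w, r, rfl⟩ := hω
      have hne : Nonempty S := ⟨r⟩
      rw [form_geometricRep] at h
      refine geometricRep_mem_pastCone cs hlor hv w ⟨not_lt.1 h, ?_⟩
      rw [form_comm, form_fundamentalWeight hlor]
      exact (hv.pos r).le
  · exact PointedCone.closure_hull_le isClosed_closure fun ω hω =>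
      PointedCone.subset_closure_hull _ hω.1

theorem pastCone_subset_titsCone (hirr : G.IsIrreducible) (hlor : G.IsLorentzian)
    (hlev : G.IsOfLevel 2) {v : S → ℝ} (hv : G.IsPerronVector v) :
    pastCone G.form v ⊆ titsCone cs := by
  rw [titsCone_eq_closure_hull cs hirr hlor hlev]
  exact pastCone_subset_closure_hull cs hirr hlor hlev hv

end GeometricCoxeterMatrix

namespace GeometricCoxeterMatrix

variable {S : Type*} {G : GeometricCoxeterMatrix S} [Fintype S] [DecidableEq S]
  {W : Type*} [Group W] (cs : CoxeterSystem G.M W)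

/-! ### Space-like weights and the structure of the Tits cone -/

theorem ne_zero_of_mem_spaceLikeWeights {ω : S → ℝ} (hω : ω ∈ spaceLikeWeights cs) : ω ≠ 0 := by
  rintro rfl
  simpa using hω.2

theorem spaceLikeWeights_subset_titsCone {ω : S → ℝ} (hω : ω ∈ spaceLikeWeights cs) :
    ω ∈ titsCone cs :=
  mem_titsCone_of_mem_weights cs hω.1

theorem spaceLikeWeights_nonempty (hlor : G.IsLorentzian) (hlev : G.IsOfLevel 2) :
    (spaceLikeWeights cs).Nonempty := by
  obtain ⟨s, hs⟩ := exists_spaceLike_fundamentalWeight hlor hlev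
  exact ⟨_, fundamentalWeight_mem_weights cs s, hs⟩

/-- Otherwise B(x, ·) ≤ 0 on the cone generated by the space-like weights, which contains x itself.
-/
theorem exists_weight_form_pos (hirr : G.IsIrreducible) (hlor : G.IsLorentzian)
    (hlev : G.IsOfLevel 2) {x : S → ℝ} (hx : x ∈ titsCone cs) (hxx : 0 < G.form x x) :
    ∃ ω ∈ spaceLikeWeights cs, 0 < G.form x ω := by
  by_contra! h
  rw [titsCone_eq_closure_hull cs hirr hlor hlev] at hx
  have := PointedCone.closure_hull_nonneg (f := -G.form x) (G.continuous_form_right x).neg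
    (fun ω hω => by simpa using h ω hω) hx
  simp only [LinearMap.neg_apply] at this
  linarith

/-- A multiple of a nonzero vector of the Tits cone inside the Tits cone is a positive one. -/
theorem pos_of_smul_mem_titsCone (hirr : G.IsIrreducible) (hlor : G.IsLorentzian) {x : S → ℝ}
    (hx : x ∈ titsCone cs) {c : ℝ} (hcx : c • x ∈ titsCone cs) (h0 : c • x ≠ 0) : 0 < c := by
  obtain ⟨v, hv⟩ := exists_isPerronVector hirr hlor
  have h1 := titsCone_form_pos cs hlor hv hcx h0
  have h2 := titsCone_form_pos cs hlor hv hx (right_ne_zero_of_smul h0)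
  rw [map_smul, LinearMap.smul_apply, smul_eq_mul] at h1
  exact pos_of_mul_pos_left h1 h2.le

/-- Write ω' = aω + π and ω = a'ω' + π' with π, π' past. If a ≥ 0, then (1 − aa')ω' = aπ' + π is
causal while ω' is space-like, so aa' = 1. Then aπ' + π = 0, which forces π = 0. -/
theorem form_neg_of_not_proportional (hlor : G.IsLorentzian) (hlev : G.IsOfLevel 2)
    {v : S → ℝ} (hv : G.IsPerronVector v) {ω ω' : S → ℝ} (hω : ω ∈ spaceLikeWeights cs)
    (hω' : ω' ∈ spaceLikeWeights cs) (hne : ∀ c : ℝ, ω' ≠ c • ω) : G.form ω' ω < 0 := by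
  have hS : Nonempty S := Fintype.card_pos_iff.1 (by have := three_le_card hlev; omega)
  have hB := hlor.isLorentzForm
  have hvv := hv.form_self_neg
  by_contra! h
  have hπ := orthProj_mem_pastCone cs hlor hlev hv hω (spaceLikeWeights_subset_titsCone cs hω')
  have hπ' := orthProj_mem_pastCone cs hlor hlev hv hω' (spaceLikeWeights_subset_titsCone cs hω)
  have e := eq_smul_add_orthProj G.form ω ω'
  have e' := eq_smul_add_orthProj G.form ω' ω
  set π := orthProj G.form ω ω'
  set π' := orthProj G.form ω' ω
  set a := G.form ω' ω / G.form ω ω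
  set a' := G.form ω ω' / G.form ω' ω'
  have ha : 0 ≤ a := div_nonneg h hω.2.le
  have hsum : (1 - a * a') • ω' = a • π' + π := by
    have : ω' = a • (a' • ω' + π') + π := by rw [← e']; exact e
    calc (1 - a * a') • ω' = ω' - (a * a') • ω' := by module
      _ = a • (a' • ω' + π') + π - (a * a') • ω' := by rw [← this]
      _ = a • π' + π := by module
  have hpast : a • π' + π ∈ pastCone G.form v :=
    hB.past_add hvv (IsLorentzForm.past_smul hπ' ha) hπ
  have h1 : 1 - a * a' = 0 := by
    by_contra h1
    have h2 := hpast.1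
    rw [← hsum] at h2
    simp only [map_smul, LinearMap.smul_apply, smul_eq_mul] at h2
    rw [← mul_assoc] at h2
    exact h2.not_gt (mul_pos (mul_self_pos.2 h1) hω'.2)
  rw [h1, zero_smul] at hsum
  have h3 : G.form π v = 0 := by
    have h4 := congrArg (fun z => G.form z v) hsum
    simp only [map_zero, LinearMap.zero_apply, map_add, map_smul, LinearMap.add_apply,
      LinearMap.smul_apply, smul_eq_mul] at h4
    linarith [hπ.2, mul_nonneg ha hπ'.2]
  have h5 : π = 0 := by
    by_contra h5
    exact (hB.past_pos hvv hπ h5).ne' h3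
  exact hne a (by rw [h5, add_zero] at e; exact e)

/-- A past causal vector orthogonal to a space-like weight gives a supporting hyperplane. -/
theorem form_nonpos_of_orthogonal (hlor : G.IsLorentzian) (hlev : G.IsOfLevel 2)
    {v : S → ℝ} (hv : G.IsPerronVector v) {ω ξ z : S → ℝ} (hω : ω ∈ spaceLikeWeights cs)
    (hξ : ξ ∈ pastCone G.form v) (hξω : G.form ξ ω = 0) (hz : z ∈ titsCone cs) :
    G.form ξ z ≤ 0 := by
  have hS : Nonempty S := Fintype.card_pos_iff.1 (by have := three_le_card hlev; omega)
  rw [eq_smul_add_orthProj G.form ω z, map_add, map_smul, hξω, smul_zero, zero_add]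
  exact hlor.isLorentzForm.past_form_nonpos hv.form_self_neg hξ
    (orthProj_mem_pastCone cs hlor hlev hv hω hz)

theorem exists_timelike_orthogonal (hirr : G.IsIrreducible) (hlor : G.IsLorentzian)
    (hlev : G.IsOfLevel 2)
    {v : S → ℝ} (hv : G.IsPerronVector v) {ω : S → ℝ} (hω : ω ∈ spaceLikeWeights cs) :
    ∃ e ∈ pastCone G.form v, G.form e ω = 0 ∧ G.form e e < 0 := by
  have hS : Nonempty S := Fintype.card_pos_iff.1 (by have := three_le_card hlev; omega)
  have hvv := hv.form_self_neg
  have hvp : -v ∈ pastCone G.form v := ⟨by simpa using hvv.le, by simpa using hvv.le⟩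
  refine ⟨orthProj G.form ω (-v), orthProj_mem_pastCone cs hlor hlev hv hω
    (pastCone_subset_titsCone cs hirr hlor hlev hv hvp), form_orthProj hω.2 _, ?_⟩
  rw [orthProj_apply]
  exact hlor.isLorentzForm.projection_neg (by simpa using hvv) hω.2

/-! ### Vertices -/

/-- Each past ξ orthogonal to ω gives the supporting functional −B(ξ, ·). A time-like ξ can be
perturbed in every direction orthogonal to ω, so these functionals vanish together only on the line
of ω. -/
theorem mk_mem_projVertices (hirr : G.IsIrreducible) (hlor : G.IsLorentzian)
    (hlev : G.IsOfLevel 2) {ω : S → ℝ} (hω : ω ∈ spaceLikeWeights cs) (h0 : ω ≠ 0) :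
    Projectivization.mk ℝ ω h0 ∈ projVertices (titsCone cs) := by
  obtain ⟨v, hv⟩ := exists_isPerronVector hirr hlor
  have hS : Nonempty S := Fintype.card_pos_iff.1 (by have := three_le_card hlev; omega)
  have hB := hlor.isLorentzForm
  have hvv := hv.form_self_neg
  refine ⟨⟨ω, spaceLikeWeights_subset_titsCone cs hω, h0, rfl⟩, fun y hy => ?_⟩
  rw [Projectivization.submodule_mk] at hy ⊢
  have hξ : ∀ ξ ∈ pastCone G.form v, G.form ξ ω = 0 → G.form ξ y = 0 := fun ξ hξ hξω => by
    have := hy (-G.form ξ) (fun z hz => by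
      simpa using form_nonpos_of_orthogonal cs hlor hlev hv hω hξ hξω hz) (fun x hx => by
      obtain ⟨c, rfl⟩ := Submodule.mem_span_singleton.1 hx
      simp [hξω])
    simpa using this
  obtain ⟨e, he, heω, hee⟩ := exists_timelike_orthogonal cs hirr hlor hlev hv hω
  have ey := eq_smul_add_orthProj G.form ω y
  have huω : G.form (orthProj G.form ω y) ω = 0 := form_orthProj hω.2 y
  set u := orthProj G.form ω y
  have hey := hξ e he heω
  have heu : G.form e u = 0 := by
    rw [ey, map_add, map_smul, heω, smul_zero, zero_add] at hey
    exact hey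
  obtain ⟨ε, hε, h1, -⟩ := hB.exists_perturbation hvv he hee u
  have huy : G.form u y = 0 := by
    have h2 := hξ _ h1 (by simp [heω, huω])
    simp only [map_add, map_smul, LinearMap.add_apply, LinearMap.smul_apply, smul_eq_mul, hey,
      zero_add] at h2
    exact (mul_eq_zero.1 h2).resolve_left hε.ne'
  have huu : G.form u u = 0 := by
    rw [ey, map_add, map_smul, huω, smul_zero, zero_add] at huy
    exact huy
  have hu0 : u = 0 := hB.eq_zero_of_orthogonal hee heu huu.le
  rw [hu0, add_zero] at ey
  exact Submodule.mem_span_singleton.2 ⟨_, ey.symm⟩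

/-- A space-like x is aω + π with a > 0 and both terms in the cone, so every supporting hyperplane
through x contains ω. At a causal x, a supporting functional is B(y, ·) with y proportional to x,
and a single hyperplane does not isolate a point in rank at least 3. -/
theorem exists_weight_of_mem_projVertices (hirr : G.IsIrreducible) (hlor : G.IsLorentzian)
    (hlev : G.IsOfLevel 2) {p : ℙ ℝ (S → ℝ)} (hp : p ∈ projVertices (titsCone cs)) :
    ∃ ω ∈ spaceLikeWeights cs, ∃ h0 : ω ≠ 0, Projectivization.mk ℝ ω h0 = p := by
  obtain ⟨v, hv⟩ := exists_isPerronVector hirr hlor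
  have hS : Nonempty S := Fintype.card_pos_iff.1 (by have := three_le_card hlev; omega)
  have hB := hlor.isLorentzForm
  have hvv := hv.form_self_neg
  obtain ⟨⟨x, hx, hx0, rfl⟩, hvert⟩ := hp
  rw [Projectivization.submodule_mk] at hvert
  have hxv := titsCone_form_pos cs hlor hv hx hx0
  by_cases hxx : 0 < G.form x x
  · obtain ⟨ω, hω, hxω⟩ := exists_weight_form_pos cs hirr hlor hlev hx hxx
    refine ⟨ω, hω, ne_zero_of_mem_spaceLikeWeights cs hω, ?_⟩
    have hmem := hvert ω fun f hf hfx => by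
      have h1 := hfx x (Submodule.mem_span_singleton_self x)
      rw [eq_smul_add_orthProj G.form ω x, map_add, map_smul, smul_eq_mul] at h1
      have h2 := hf ω (spaceLikeWeights_subset_titsCone cs hω)
      have h3 := hf _ (pastCone_subset_titsCone cs hirr hlor hlev hv
        (orthProj_mem_pastCone cs hlor hlev hv hω hx))
      have ha := div_pos hxω hω.2
      nlinarith [mul_nonneg ha.le h2]
    obtain ⟨c, hc⟩ := Submodule.mem_span_singleton.1 hmem
    exact (Projectivization.mk_eq_mk_iff' ℝ _ _ _ hx0).2 ⟨c, hc⟩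
  · exfalso
    have hxp : x ∈ pastCone G.form v := ⟨not_lt.1 hxx, hxv.le⟩
    obtain ⟨u, hu0, hxu, hvu⟩ := exists_ne_zero_of_two_functionals
      (by rw [Module.finrank_fintype_fun_eq_card]; exact three_le_card hlev) (G.form x) (G.form v)
    have hmem := hvert u fun f hf hfx => by
      obtain ⟨y, hy⟩ := exists_form_eq hlor f
      have hyp := neg_mem_pastCone_of_dual cs hirr hlor hlev hv (y := y) fun ω hω => by
        rw [hy]; exact hf ω (spaceLikeWeights_subset_titsCone cs hω)
      obtain ⟨c, -, hc⟩ := hB.past_proportional hvv hxp hyp hx0 (by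
        rw [G.form_comm, map_neg, LinearMap.neg_apply, hy,
          hfx x (Submodule.mem_span_singleton_self x), neg_zero])
      rw [← hy, neg_eq_iff_eq_neg.1 hc, map_neg, LinearMap.neg_apply, map_smul,
        LinearMap.smul_apply, hxu, smul_zero, neg_zero]
    obtain ⟨c, rfl⟩ := Submodule.mem_span_singleton.1 hmem
    rw [map_smul, smul_eq_mul, G.form_comm] at hvu
    rw [(mul_eq_zero.1 hvu).resolve_right hxv.ne', zero_smul] at hu0
    exact hu0 rfl

/-- With finitely many vertices, the space-like weights scaled to norm 1 form a finite W-stable set.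
Its sum is fixed by W, hence orthogonal to all simple roots, hence zero; but all summands lie
strictly on the past side. -/
theorem projVertices_infinite (hirr : G.IsIrreducible) (hlor : G.IsLorentzian)
    (hlev : G.IsOfLevel 2) : (projVertices (titsCone cs)).Infinite := by
  obtain ⟨v, hv⟩ := exists_isPerronVector hirr hlor
  intro hfin
  let U : Set (S → ℝ) := {u | G.form u u = 1 ∧ ∃ ω ∈ spaceLikeWeights cs, ∃ a : ℝ, 0 < a ∧
    u = a • ω}
  have hUT : ∀ u ∈ U, u ∈ titsCone cs := by
    rintro u ⟨-, ω, hω, a, ha, rfl⟩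
    exact PointedCone.smul_mem _ ha.le (spaceLikeWeights_subset_titsCone cs hω)
  have hU0 : ∀ u ∈ U, u ≠ 0 := by
    rintro u ⟨h1, -⟩ rfl
    simp at h1
  have hUinv : ∀ (w : W), ∀ u ∈ U, geometricRep cs w u ∈ U := by
    rintro w u ⟨h1, ω, hω, a, ha, rfl⟩
    exact ⟨by rw [form_geometricRep, h1], _, geometricRep_mem_spaceLikeWeights cs w hω, a, ha,
      map_smul _ _ _⟩
  have hUfin : U.Finite := by
    refine Set.Finite.subset (hfin.biUnion (t := fun p => {u | u ∈ U ∧ u ∈ p.submodule})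
      fun p _ => Set.Subsingleton.finite ?_) ?_
    · rintro u ⟨hu, hup⟩ u' ⟨hu', hup'⟩
      rw [Projectivization.submodule_eq, Submodule.mem_span_singleton] at hup hup'
      obtain ⟨c, hc⟩ := hup
      obtain ⟨c', hc'⟩ := hup'
      have hc0 : c ≠ 0 := by
        rintro rfl
        exact hU0 u hu (by rw [← hc, zero_smul])
      have e : u' = (c' / c) • u := by
        rw [← hc, smul_smul, div_mul_cancel₀ _ hc0, hc']
      have hpos : 0 < c' / c := pos_of_smul_mem_titsCone cs hirr hlor (hUT u hu)
        (by rw [← e]; exact hUT u' hu') (by rw [← e]; exact hU0 u' hu')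
      have h1 := hu'.1
      rw [e] at h1
      simp only [map_smul, LinearMap.smul_apply, smul_eq_mul, hu.1, mul_one] at h1
      have h2 : c' / c = 1 := by nlinarith
      rw [e, h2, one_smul]
    · rintro u hu
      obtain ⟨h1, ω, hω, a, ha, rfl⟩ := id hu
      have h0 := ne_zero_of_mem_spaceLikeWeights cs hω
      refine Set.mem_biUnion (mk_mem_projVertices cs hirr hlor hlev hω h0) ⟨hu, ?_⟩
      rw [Projectivization.submodule_mk]
      exact Submodule.smul_mem _ _ (Submodule.mem_span_singleton_self ω)
  set σ := ∑ u ∈ hUfin.toFinset, u with hσ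
  have hinv : ∀ w : W, geometricRep cs w σ = σ := fun w => by
    rw [hσ, map_sum]
    refine Finset.sum_nbij' (fun u => geometricRep cs w u) (fun u => geometricRep cs w⁻¹ u)
      ?_ ?_ ?_ ?_ ?_
    · intro u hu; simpa using hUinv w u (by simpa using hu)
    · intro u hu; simpa using hUinv w⁻¹ u (by simpa using hu)
    · intro u _
      rw [← geometricRep_mul_apply, inv_mul_cancel, geometricRep_one_apply]
    · intro u _
      rw [← geometricRep_mul_apply, mul_inv_cancel, geometricRep_one_apply]
    · intro u _; rfl
  have hσ0 : σ = 0 := by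
    obtain ⟨u, hu⟩ := hlor.exists_form_neg
    refine hlor.isLorentzForm.eq_zero_of_forall hu fun y => ?_
    rw [form_eq_sum]
    refine Finset.sum_eq_zero fun s _ => ?_
    have h := hinv (cs.simple s)
    rw [geometricRep_simple, simpleReflection_apply, sub_eq_self] at h
    have h1 := congrFun h s
    simp only [Pi.smul_apply, simpleRoot, Pi.single_eq_same, smul_eq_mul, Pi.zero_apply] at h1
    have h2 : G.form σ (simpleRoot s) = 0 := by
      unfold simpleRoot; linarith
    rw [h2, mul_zero]
  have hpos : 0 < G.form σ v := by
    rw [hσ, map_sum, LinearMap.sum_apply]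
    refine Finset.sum_pos (fun u hu => ?_) ?_
    · have hu' : u ∈ U := by simpa using hu
      exact titsCone_form_pos cs hlor hv (hUT u hu') (hU0 u hu')
    · obtain ⟨ω, hω⟩ := spaceLikeWeights_nonempty cs hlor hlev
      have hs : 0 < Real.sqrt (G.form ω ω) := Real.sqrt_pos.2 hω.2
      refine ⟨(Real.sqrt (G.form ω ω))⁻¹ • ω, ?_⟩
      rw [Set.Finite.mem_toFinset]
      refine ⟨?_, ω, hω, _, inv_pos.2 hs, rfl⟩
      simp only [map_smul, LinearMap.smul_apply, smul_eq_mul]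
      rw [← mul_assoc, ← mul_inv, Real.mul_self_sqrt hω.2.le, inv_mul_cancel₀ hω.2.ne']
  rw [hσ0] at hpos
  simp at hpos

theorem titsCone_eq_closure_hull_vertices (hirr : G.IsIrreducible) (hlor : G.IsLorentzian)
    (hlev : G.IsOfLevel 2) :
    titsCone cs = (PointedCone.hull ℝ {x | ∃ hx : x ≠ 0, x ∈ titsCone cs ∧
      Projectivization.mk ℝ x hx ∈ projVertices (titsCone cs)}).closure := by
  apply le_antisymm
  · conv_lhs => rw [titsCone_eq_closure_hull cs hirr hlor hlev]
    refine PointedCone.closure_hull_le isClosed_closure fun ω hω => ?_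
    have h0 := ne_zero_of_mem_spaceLikeWeights cs hω
    exact PointedCone.subset_closure_hull _ ⟨h0, spaceLikeWeights_subset_titsCone cs hω,
      mk_mem_projVertices cs hirr hlor hlev hω h0⟩
  · exact PointedCone.closure_hull_le isClosed_closure fun x ⟨_, hx, _⟩ => hx

/-! ### Edges -/

/-- A time-like past vector is interior to the Tits cone, and a face through an interior point spans
V, of dimension at least 3. -/
theorem form_self_eq_zero_of_mem_edge (hirr : G.IsIrreducible) (hlor : G.IsLorentzian)
    (hlev : G.IsOfLevel 2) {v : S → ℝ} (hv : G.IsPerronVector v) {F : PointedCone ℝ (S → ℝ)}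
    (hF : IsProjEdge (titsCone cs) F) {x : S → ℝ} (hxF : x ∈ F) (hx : x ∈ pastCone G.form v) :
    G.form x x = 0 := by
  have hS : Nonempty S := Fintype.card_pos_iff.1 (by have := three_le_card hlev; omega)
  by_contra hne
  have hneg : G.form x x < 0 := lt_of_le_of_ne hx.1 hne
  have htop : Submodule.span ℝ (F : Set (S → ℝ)) = ⊤ := by
    refine eq_top_iff.2 fun z _ => ?_
    obtain ⟨ε, hε, h1, h2⟩ :=
      hlor.isLorentzForm.exists_perturbation hv.form_self_neg hx hneg z
    have hmem : x + ε • z ∈ F := by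
      refine hF.1.mem_of_smul_add_mem (pastCone_subset_titsCone cs hirr hlor hlev hv h1)
        (pastCone_subset_titsCone cs hirr hlor hlev hv h2) one_pos ?_
      have e : (1 : ℝ) • (x + ε • z) + (x - ε • z) = x + x := by module
      rw [e]
      exact add_mem hxF hxF
    have e : z = ε⁻¹ • ((x + ε • z) - x) := by
      rw [add_sub_cancel_left, smul_smul, inv_mul_cancel₀ hε.ne', one_smul]
    rw [e]
    exact Submodule.smul_mem _ _ (Submodule.sub_mem _ (Submodule.subset_span hmem)
      (Submodule.subset_span hxF))
  have h2 := hF.2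
  rw [htop, finrank_top, Module.finrank_fintype_fun_eq_card] at h2
  have := three_le_card hlev
  omega

theorem finrank_span_pair_of_orthogonal {ω ξ : S → ℝ} (hω : 0 < G.form ω ω) (hξ : ξ ≠ 0)
    (h : G.form ξ ω = 0) : Module.finrank ℝ (Submodule.span ℝ {ω, ξ}) = 2 := by
  have hind : LinearIndependent ℝ ![ω, ξ] := by
    refine LinearIndependent.pair_iff.2 fun a b hab => ?_
    have ha : a = 0 := by
      have h1 := congrArg (fun z => G.form z ω) hab
      simp only [map_add, map_smul, LinearMap.add_apply, LinearMap.smul_apply, smul_eq_mul, h,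
        mul_zero, add_zero, map_zero, LinearMap.zero_apply] at h1
      exact (mul_eq_zero.1 h1).resolve_right hω.ne'
    subst ha
    simpa [hξ] using hab
  have := finrank_span_eq_card hind
  rwa [Matrix.range_cons_cons_empty, Fintype.card_fin] at this

/-- The edge contains a space-like weight ω and a nonzero past vector π orthogonal to ω, which must
be light-like. On their plane the norm of aω + cπ is a² B(ω,ω), so π spans the only null line. -/
theorem edge_tangent (hirr : G.IsIrreducible) (hlor : G.IsLorentzian) (hlev : G.IsOfLevel 2)
    {F : PointedCone ℝ (S → ℝ)} (hF : IsProjEdge (titsCone cs) F) :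
    ∃ p ∈ projSet (F : Set (S → ℝ)),
      projSet (Submodule.span ℝ (F : Set (S → ℝ)) : Set (S → ℝ)) ∩ projSet G.lightCone = {p} := by
  obtain ⟨v, hv⟩ := exists_isPerronVector hirr hlor
  have hS : Nonempty S := Fintype.card_pos_iff.1 (by have := three_le_card hlev; omega)
  have hB := hlor.isLorentzForm
  have hvv := hv.form_self_neg
  have hrank : ∀ ω : S → ℝ, ∃ x ∈ F, ∀ c : ℝ, x ≠ c • ω := fun ω => by
    by_contra! h
    have hle : Submodule.span ℝ (F : Set (S → ℝ)) ≤ Submodule.span ℝ {ω} :=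
      Submodule.span_le.2 fun x hx => by
        obtain ⟨c, hc⟩ := h x hx
        exact Submodule.mem_span_singleton.2 ⟨c, hc.symm⟩
    have h1 := Submodule.finrank_mono hle
    have h2 := finrank_span_le_card (R := ℝ) ({ω} : Set (S → ℝ))
    rw [Set.toFinset_singleton, Finset.card_singleton] at h2
    have := hF.2
    omega
  -- In a face of causal vectors, the sum of two independent ones would be light-like, which forces
  -- them to be proportional.
  obtain ⟨x, hxF, hxx⟩ : ∃ x ∈ F, 0 < G.form x x := by
    by_contra! hcausal
    have hpast : ∀ x ∈ F, x ∈ pastCone G.form v := fun x hx => by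
      refine ⟨hcausal x hx, ?_⟩
      by_cases h0 : x = 0
      · simp [h0]
      · exact (titsCone_form_pos cs hlor hv (hF.1.le hx) h0).le
    obtain ⟨x₁, hx₁, hx₁0⟩ := hrank 0
    obtain ⟨x₂, hx₂, hx₂1⟩ := hrank x₁
    have hx₁0 : x₁ ≠ 0 := by simpa using hx₁0
    have h1 := form_self_eq_zero_of_mem_edge cs hirr hlor hlev hv hF (add_mem hx₁ hx₂)
      (hpast _ (add_mem hx₁ hx₂))
    rw [hB.form_add_self] at h1
    have h2 := hB.past_form_nonpos hvv (hpast _ hx₁) (hpast _ hx₂)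
    have h3 : G.form x₁ x₂ = 0 := by linarith [hcausal _ hx₁, hcausal _ hx₂]
    obtain ⟨c, -, hc⟩ := hB.past_proportional hvv (hpast _ hx₁) (hpast _ hx₂) hx₁0 h3
    exact hx₂1 c hc
  obtain ⟨ω, hω, hxω⟩ := exists_weight_form_pos cs hirr hlor hlev (hF.1.le hxF) hxx
  have hωF : ω ∈ F := by
    refine hF.1.mem_of_smul_add_mem (spaceLikeWeights_subset_titsCone cs hω)
      (pastCone_subset_titsCone cs hirr hlor hlev hv
        (orthProj_mem_pastCone cs hlor hlev hv hω (hF.1.le hxF))) (div_pos hxω hω.2) ?_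
    rw [← eq_smul_add_orthProj]
    exact hxF
  obtain ⟨x₂, hx₂, hx₂ω⟩ := hrank ω
  have hπ := orthProj_mem_pastCone cs hlor hlev hv hω (hF.1.le hx₂)
  have e := eq_smul_add_orthProj G.form ω x₂
  have hπω : G.form (orthProj G.form ω x₂) ω = 0 := form_orthProj hω.2 x₂
  set π := orthProj G.form ω x₂
  set b := G.form x₂ ω / G.form ω ω
  have hπ0 : π ≠ 0 := fun h => hx₂ω b (by rw [h, add_zero] at e; exact e)
  -- According to the sign of `b`, either x₂ = π + bω is a sum inside the cone and the face property
  -- applies, or π = x₂ − bω is a sum of elements of F.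
  have hπF : π ∈ F := by
    by_cases hb : 0 ≤ b
    · refine hF.1.mem_of_smul_add_mem (pastCone_subset_titsCone cs hirr hlor hlev hv hπ)
        (PointedCone.smul_mem _ hb (spaceLikeWeights_subset_titsCone cs hω)) one_pos ?_
      rw [one_smul, add_comm, ← e]
      exact hx₂
    · have e' : π = x₂ + (-b) • ω := by
        conv_rhs => rw [e]
        module
      rw [e']
      exact add_mem hx₂ (PointedCone.smul_mem _ (by linarith) hωF)
  have hππ := form_self_eq_zero_of_mem_edge cs hirr hlor hlev hv hF hπF hπ
  have hspan : Submodule.span ℝ {ω, π} = Submodule.span ℝ (F : Set (S → ℝ)) := by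
    refine Submodule.eq_of_le_of_finrank_eq (Submodule.span_mono ?_) ?_
    · rintro z (rfl | rfl)
      · exact hωF
      · exact hπF
    · rw [hF.2, finrank_span_pair_of_orthogonal hω.2 hπ0 hπω]
  refine ⟨Projectivization.mk ℝ π hπ0, ⟨π, hπF, hπ0, rfl⟩, Set.eq_singleton_iff_unique_mem.2
    ⟨⟨⟨π, Submodule.subset_span hπF, hπ0, rfl⟩, ⟨π, hππ, hπ0, rfl⟩⟩, ?_⟩⟩
  rintro q ⟨⟨y, hy, hy0, rfl⟩, ⟨y', hy', hy'0, heq⟩⟩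
  obtain ⟨k, hk⟩ := (Projectivization.mk_eq_mk_iff' ℝ _ _ hy0 hy'0).1 heq.symm
  have hyy : G.form y y = 0 := by
    have : G.form y' y' = 0 := hy'
    rw [← hk]
    simp [this]
  rw [SetLike.mem_coe, ← hspan] at hy
  obtain ⟨a, c, rfl⟩ := Submodule.mem_span_pair.1 hy
  simp only [map_add, map_smul, LinearMap.add_apply, LinearMap.smul_apply, smul_eq_mul, hππ, hπω,
    G.form_comm ω π, mul_zero, add_zero] at hyy
  have ha : a = 0 := by simpa [hω.2.ne'] using hyy
  exact (Projectivization.mk_eq_mk_iff' ℝ _ _ _ hπ0).2 ⟨c, by simp [ha]⟩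

/-! ### Balls and tangency -/

theorem ball_smul (ω : S → ℝ) {c : ℝ} (hc : 0 < c) : G.ball (c • ω) = G.ball ω := by
  have h : ∀ x, G.form (c • ω) x ≤ 0 ↔ G.form ω x ≤ 0 := fun x => by
    rw [map_smul, LinearMap.smul_apply, smul_eq_mul]
    exact ⟨fun h => le_of_mul_le_mul_left (by simpa using h) hc,
      fun h => mul_nonpos_of_nonneg_of_nonpos hc.le h⟩
  unfold ball
  simp only [h]

theorem orthProj_ne_zero {ω ω' : S → ℝ} (hne : ∀ c : ℝ, ω' ≠ c • ω) :
    orthProj G.form ω ω' ≠ 0 := fun h => by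
  have e := eq_smul_add_orthProj G.form ω ω'
  rw [h, add_zero] at e
  exact hne _ e

/-- Two balls meet only if the weights span a line tangent to the light cone, and then only in the
point of tangency. -/
theorem eq_mk_orthProj_of_mem_ball_inter (hlor : G.IsLorentzian) (hlev : G.IsOfLevel 2)
    {v : S → ℝ} (hv : G.IsPerronVector v) {ω ω' : S → ℝ} (hω : ω ∈ spaceLikeWeights cs)
    (hω' : ω' ∈ spaceLikeWeights cs) (hne : ∀ c : ℝ, ω' ≠ c • ω) {p : ℙ ℝ (S → ℝ)}
    (hp : p ∈ G.ball ω ∩ G.ball ω') :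
    G.form (orthProj G.form ω ω') (orthProj G.form ω ω') = 0 ∧
      p = Projectivization.mk ℝ (orthProj G.form ω ω') (orthProj_ne_zero hne) := by
  have hS : Nonempty S := Fintype.card_pos_iff.1 (by have := three_le_card hlev; omega)
  have hB := hlor.isLorentzForm
  have hvv := hv.form_self_neg
  obtain ⟨x, hx, hx0, rfl⟩ := exists_past_of_mem_ball hlor hlev hv hp.1
  obtain ⟨hxx, hωx⟩ := (mem_ball_iff hlor hlev hv hx0 hx).1 hp.1
  have hω'x := ((mem_ball_iff hlor hlev hv hx0 hx).1 hp.2).2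
  have hπ := orthProj_mem_pastCone cs hlor hlev hv hω (spaceLikeWeights_subset_titsCone cs hω')
  have hπ0 := orthProj_ne_zero (G := G) hne
  rw [eq_smul_add_orthProj G.form ω ω', map_add, map_smul, LinearMap.add_apply,
    LinearMap.smul_apply, smul_eq_mul] at hω'x
  set π := orthProj G.form ω ω'
  have ha := div_neg_of_neg_of_pos
    (form_neg_of_not_proportional cs hlor hlev hv hω hω' hne) hω.2
  have h1 := hB.past_form_nonpos hvv hπ hx
  -- B(ω', x) = a B(ω, x) + B(π, x) is nonnegative although both terms on the right are nonpositive.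
  have h2 : G.form x π = 0 := by
    rw [form_comm]
    nlinarith [mul_nonneg (neg_nonneg.2 ha.le) hωx]
  obtain ⟨c, -, hc⟩ := hB.past_proportional hvv hx hπ hx0 h2
  have hππ : G.form π π = 0 := by rw [hc]; simp [hxx]
  refine ⟨hππ, ?_⟩
  exact ((Projectivization.mk_eq_mk_iff' ℝ _ _ _ hx0).2 ⟨c, hc.symm⟩).symm

theorem mk_orthProj_mem_ball_inter (hlor : G.IsLorentzian) (hlev : G.IsOfLevel 2)
    {v : S → ℝ} (hv : G.IsPerronVector v) {ω ω' : S → ℝ} (hω : ω ∈ spaceLikeWeights cs)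
    (hω' : ω' ∈ spaceLikeWeights cs) (hne : ∀ c : ℝ, ω' ≠ c • ω)
    (h : G.form (orthProj G.form ω ω') (orthProj G.form ω ω') = 0) :
    Projectivization.mk ℝ (orthProj G.form ω ω') (orthProj_ne_zero hne) ∈
      G.ball ω ∩ G.ball ω' := by
  have hπ := orthProj_mem_pastCone cs hlor hlev hv hω (spaceLikeWeights_subset_titsCone cs hω')
  have hπω : G.form ω (orthProj G.form ω ω') = 0 := by
    rw [form_comm]; exact form_orthProj hω.2 ω'
  have e := eq_smul_add_orthProj G.form ω ω'
  have hπω' : G.form ω' (orthProj G.form ω ω') = 0 := by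
    have h1 := congrArg (fun z => G.form z (orthProj G.form ω ω')) e
    simp only [map_add, map_smul, LinearMap.add_apply, LinearMap.smul_apply, hπω, h,
      smul_zero, add_zero] at h1
    exact h1
  exact ⟨(mem_ball_iff hlor hlev hv _ hπ).2 ⟨h, hπω.ge⟩,
    (mem_ball_iff hlor hlev hv _ hπ).2 ⟨h, hπω'.ge⟩⟩

/-- The ball of a space-like weight has at least two points. -/
theorem ball_not_subset_singleton (hirr : G.IsIrreducible) (hlor : G.IsLorentzian)
    (hlev : G.IsOfLevel 2) {v : S → ℝ} (hv : G.IsPerronVector v) {ω : S → ℝ}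
    (hω : ω ∈ spaceLikeWeights cs) (p : ℙ ℝ (S → ℝ)) : ¬ G.ball ω ⊆ {p} := by
  have hS : Nonempty S := Fintype.card_pos_iff.1 (by have := three_le_card hlev; omega)
  have hB := hlor.isLorentzForm
  have hvv := hv.form_self_neg
  intro hsub
  obtain ⟨e, he, heω, hee⟩ := exists_timelike_orthogonal cs hirr hlor hlev hv hω
  -- The two points come from light-like vectors e ± tu orthogonal to ω, hence on the boundary of
  -- the ball.
  obtain ⟨u, hu0, heu, hωu⟩ := exists_ne_zero_of_two_functionals
    (by rw [Module.finrank_fintype_fun_eq_card]; exact three_le_card hlev) (G.form e) (G.form ω)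
  obtain ⟨t, ht, h1, h2⟩ := hB.exists_lightlike hee hu0 heu
  have hωe : G.form ω e = 0 := by rw [form_comm, heω]
  have key : ∀ c : ℝ, G.form (e + c • u) (e + c • u) = 0 →
      ∃ h0 : e + c • u ≠ 0, Projectivization.mk ℝ (e + c • u) h0 ∈ G.ball ω := fun c hc => by
    have hce : G.form (e + c • u) e = G.form e e := by
      simp [G.form_comm u e, heu]
    have h0 : e + c • u ≠ 0 := fun h => by
      rw [h] at hce
      simp at hce
      exact hee.ne hce.symm
    have hpast : e + c • u ∈ pastCone G.form v :=
      hB.mem_past_of_form_nonneg hvv (u := -e) hc.le (by simpa using hee) (by simpa using he.2)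
        (by rw [map_neg, hce]; linarith)
    exact ⟨h0, (mem_ball_iff hlor hlev hv h0 hpast).2 ⟨hc, by simp [hωe, hωu]⟩⟩
  obtain ⟨ha, hpa⟩ := key t h1
  obtain ⟨hb, hpb⟩ := key (-t) (by rw [neg_smul, ← sub_eq_add_neg]; exact h2)
  have heq := (hsub hpa).trans (hsub hpb).symm
  obtain ⟨k, hk⟩ := (Projectivization.mk_eq_mk_iff' ℝ _ _ ha hb).1 heq
  have hke := congrArg (G.form e) hk
  simp only [map_smul, map_add, heu, smul_eq_mul, mul_zero, add_zero] at hke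
  have hk1 : k = 1 := mul_right_cancel₀ hee.ne (by rw [hke, one_mul])
  rw [hk1, one_smul, add_right_inj] at hk
  have : (2 * t) • u = 0 := by
    calc (2 * t) • u = t • u - (-t) • u := by module
      _ = 0 := by rw [hk, sub_self]
  exact (smul_ne_zero (by linarith) hu0) this

/-- The balls of non-proportional weights share at most one point, whereas a ball has at least two.
-/
theorem ball_eq_ball_iff (hirr : G.IsIrreducible) (hlor : G.IsLorentzian)
    (hlev : G.IsOfLevel 2) {ω ω' : S → ℝ} (hω : ω ∈ spaceLikeWeights cs)
    (hω' : ω' ∈ spaceLikeWeights cs) : G.ball ω' = G.ball ω ↔ ∃ c : ℝ, ω' = c • ω := by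
  obtain ⟨v, hv⟩ := exists_isPerronVector hirr hlor
  constructor
  · intro h
    by_contra! hne
    exact ball_not_subset_singleton cs hirr hlor hlev hv hω
      (Projectivization.mk ℝ (orthProj G.form ω ω') (orthProj_ne_zero hne)) fun p hp =>
        (eq_mk_orthProj_of_mem_ball_inter cs hlor hlev hv hω hω' hne ⟨hp, h ▸ hp⟩).2
  · rintro ⟨c, rfl⟩
    exact ball_smul ω (pos_of_smul_mem_titsCone cs hirr hlor
      (spaceLikeWeights_subset_titsCone cs hω) (spaceLikeWeights_subset_titsCone cs hω')
      (ne_zero_of_mem_spaceLikeWeights cs hω'))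

theorem exists_ball_inter_eq_singleton_iff (hirr : G.IsIrreducible) (hlor : G.IsLorentzian)
    (hlev : G.IsOfLevel 2) {ω ω' : S → ℝ} (hω : ω ∈ spaceLikeWeights cs)
    (hω' : ω' ∈ spaceLikeWeights cs) (hne : ∀ c : ℝ, ω' ≠ c • ω) :
    (∃ p, G.ball ω ∩ G.ball ω' = {p}) ↔
      G.form (orthProj G.form ω ω') (orthProj G.form ω ω') = 0 := by
  obtain ⟨v, hv⟩ := exists_isPerronVector hirr hlor
  constructor
  · rintro ⟨p, hp⟩
    exact (eq_mk_orthProj_of_mem_ball_inter cs hlor hlev hv hω hω' hne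
      (hp ▸ Set.mem_singleton p)).1
  · intro h
    exact ⟨_, Set.eq_singleton_iff_unique_mem.2
      ⟨mk_orthProj_mem_ball_inter cs hlor hlev hv hω hω' hne h, fun q hq =>
        (eq_mk_orthProj_of_mem_ball_inter cs hlor hlev hv hω hω' hne hq).2⟩⟩

theorem mem_of_mk_mem_projSet (hirr : G.IsIrreducible) (hlor : G.IsLorentzian)
    {F : PointedCone ℝ (S → ℝ)} (hF : F ≤ titsCone cs) {x : S → ℝ} (hx : x ∈ titsCone cs)
    (h0 : x ≠ 0) (h : Projectivization.mk ℝ x h0 ∈ projSet (F : Set (S → ℝ))) : x ∈ F := by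
  obtain ⟨y, hy, hy0, heq⟩ := h
  obtain ⟨c, rfl⟩ := (Projectivization.mk_eq_mk_iff' ℝ _ _ h0 hy0).1 heq.symm
  exact PointedCone.smul_mem _ (pos_of_smul_mem_titsCone cs hirr hlor (hF hy) hx h0).le hy

/-- Let π be the projection of ω'. Since B(ω', ω) < 0, π is a positive combination of ω' and ω, so
it lies on any common edge and must be light-like. Conversely, a light-like π supports the cone
along an edge. -/
theorem exists_edge_iff (hirr : G.IsIrreducible) (hlor : G.IsLorentzian)
    (hlev : G.IsOfLevel 2) {ω ω' : S → ℝ} (hω : ω ∈ spaceLikeWeights cs)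
    (hω' : ω' ∈ spaceLikeWeights cs) (hne : ∀ c : ℝ, ω' ≠ c • ω) (h0 : ω ≠ 0) (h0' : ω' ≠ 0) :
    (∃ F : PointedCone ℝ (S → ℝ), IsProjEdge (titsCone cs) F ∧
      Projectivization.mk ℝ ω h0 ∈ projSet (F : Set (S → ℝ)) ∧
      Projectivization.mk ℝ ω' h0' ∈ projSet (F : Set (S → ℝ))) ↔
      G.form (orthProj G.form ω ω') (orthProj G.form ω ω') = 0 := by
  obtain ⟨v, hv⟩ := exists_isPerronVector hirr hlor
  have hS : Nonempty S := Fintype.card_pos_iff.1 (by have := three_le_card hlev; omega)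
  have hB := hlor.isLorentzForm
  have hvv := hv.form_self_neg
  have hωT := spaceLikeWeights_subset_titsCone cs hω
  have hωT' := spaceLikeWeights_subset_titsCone cs hω'
  have hπ := orthProj_mem_pastCone cs hlor hlev hv hω hωT'
  have hπ0 := orthProj_ne_zero (G := G) hne
  have hπω : G.form (orthProj G.form ω ω') ω = 0 := form_orthProj hω.2 ω'
  have e := eq_smul_add_orthProj G.form ω ω'
  constructor
  · rintro ⟨F, hF, hp, hp'⟩
    have h1 := mem_of_mk_mem_projSet cs hirr hlor hF.1.le hωT h0 hp
    have h2 := mem_of_mk_mem_projSet cs hirr hlor hF.1.le hωT' h0' hp'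
    refine form_self_eq_zero_of_mem_edge cs hirr hlor hlev hv hF ?_ hπ
    rw [orthProj_apply, sub_eq_add_neg, ← neg_smul]
    exact add_mem h2 (PointedCone.smul_mem _ (neg_nonneg.2 (div_neg_of_neg_of_pos
      (form_neg_of_not_proportional cs hlor hlev hv hω hω' hne) hω.2).le) h1)
  · intro hππ
    set π := orthProj G.form ω ω'
    have hπT := pastCone_subset_titsCone cs hirr hlor hlev hv hπ
    have hsupp : ∀ z ∈ titsCone cs, G.form π z ≤ 0 := fun z hz =>
      form_nonpos_of_orthogonal cs hlor hlev hv hω hπ hπω hz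
    -- For z in this face, the projection of z along ω is past and orthogonal to the past vector π,
    -- hence a multiple of π. So the face spans only the plane of ω and π.
    let F : PointedCone ℝ (S → ℝ) :=
      titsCone cs ⊓ PointedCone.ofSubmodule (LinearMap.ker (G.form π))
    have hFmem : ∀ z, z ∈ F ↔ z ∈ titsCone cs ∧ G.form π z = 0 := fun z => Iff.rfl
    have hωF : ω ∈ F := (hFmem ω).2 ⟨hωT, hπω⟩
    have hπF : π ∈ F := (hFmem π).2 ⟨hπT, hππ⟩
    have hω'F : ω' ∈ F := (hFmem ω').2 ⟨hωT', by
      rw [e, map_add, map_smul, hπω, smul_zero, zero_add]; exact hππ⟩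
    refine ⟨F, ⟨⟨inf_le_left, fun {x y a} hx hy ha hxy => ?_⟩, ?_⟩, ⟨ω, hωF, h0, rfl⟩,
      ⟨ω', hω'F, h0', rfl⟩⟩
    · have h1 := ((hFmem _).1 hxy).2
      rw [map_add, map_smul, smul_eq_mul] at h1
      refine (hFmem x).2 ⟨hx, le_antisymm (hsupp x hx) ?_⟩
      have h2 := hsupp y hy
      by_contra! h3
      nlinarith [mul_neg_of_pos_of_neg ha h3]
    · have hspan : Submodule.span ℝ (F : Set (S → ℝ)) = Submodule.span ℝ {ω, π} := by
        refine le_antisymm (Submodule.span_le.2 fun z hz => ?_) (Submodule.span_mono ?_)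
        · obtain ⟨hzT, hπz⟩ := (hFmem z).1 hz
          have hzπ := orthProj_mem_pastCone cs hlor hlev hv hω hzT
          have ez := eq_smul_add_orthProj G.form ω z
          have h1 : G.form π (orthProj G.form ω z) = 0 := by
            rw [ez, map_add, map_smul, hπω, smul_zero, zero_add] at hπz
            exact hπz
          obtain ⟨c, -, hc⟩ := hB.past_proportional hvv hπ hzπ hπ0 h1
          rw [hc] at ez
          exact Submodule.mem_span_pair.2 ⟨_, c, ez.symm⟩
        · rintro z (rfl | rfl)
          · exact hωF
          · exact hπF
      rw [hspan, finrank_span_pair_of_orthogonal hω.2 hπ0 hπω]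

end GeometricCoxeterMatrix

namespace GeometricCoxeterMatrix

variable {S : Type*} {G : GeometricCoxeterMatrix S} [Fintype S] [DecidableEq S]
  {W : Type*} [Group W] (cs : CoxeterSystem G.M W)

/-! ### The tangency graph and the `1`-skeleton -/

theorem exists_iso_tangencyGraph_projSkeleton (hirr : G.IsIrreducible) (hlor : G.IsLorentzian)
    (hlev : G.IsOfLevel 2) :
    ∃ f : tangencyGraph (boydMaxwell cs) ≃g projSkeleton (titsCone cs),
      ∀ (ω : S → ℝ) (hω : ω ∈ spaceLikeWeights cs) (h0 : ω ≠ 0),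
        (f ⟨G.ball ω, Set.mem_image_of_mem _ hω⟩ : ℙ ℝ (S → ℝ)) = Projectivization.mk ℝ ω h0 := by
  have hrep : ∀ b : boydMaxwell cs, ∃ ω ∈ spaceLikeWeights cs, G.ball ω = b := fun b => b.2
  choose ρ hρ hρb using hrep
  have hρ0 := fun b => ne_zero_of_mem_spaceLikeWeights cs (hρ b)
  let φ : boydMaxwell cs → projVertices (titsCone cs) := fun b =>
    ⟨Projectivization.mk ℝ (ρ b) (hρ0 b), mk_mem_projVertices cs hirr hlor hlev (hρ b) (hρ0 b)⟩
  -- The choice of representatives does not matter, because weights with equal balls are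
  -- proportional.
  have hφ : ∀ (ω : S → ℝ) (hω : ω ∈ spaceLikeWeights cs) (h0 : ω ≠ 0),
      (φ ⟨G.ball ω, Set.mem_image_of_mem _ hω⟩ : ℙ ℝ (S → ℝ)) = Projectivization.mk ℝ ω h0 :=
    fun ω hω h0 => by
      obtain ⟨c, hc⟩ := (ball_eq_ball_iff cs hirr hlor hlev hω (hρ _)).1
        (hρb ⟨G.ball ω, Set.mem_image_of_mem _ hω⟩)
      exact (Projectivization.mk_eq_mk_iff' ℝ _ _ _ h0).2 ⟨c, hc.symm⟩
  have hinj : Function.Injective φ := fun b b' h => by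
    obtain ⟨c, hc⟩ := (Projectivization.mk_eq_mk_iff' ℝ _ _ _ _).1 (congrArg Subtype.val h)
    refine Subtype.ext ?_
    rw [← hρb b, ← hρb b']
    exact (ball_eq_ball_iff cs hirr hlor hlev (hρ b') (hρ b)).2 ⟨c, hc.symm⟩
  have hsurj : Function.Surjective φ := fun p => by
    obtain ⟨ω, hω, h0, hp⟩ := exists_weight_of_mem_projVertices cs hirr hlor hlev p.2
    exact ⟨⟨G.ball ω, Set.mem_image_of_mem _ hω⟩, Subtype.ext ((hφ ω hω h0).trans hp)⟩
  refine ⟨⟨Equiv.ofBijective φ ⟨hinj, hsurj⟩, fun {b b'} => ?_⟩, hφ⟩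
  change (φ b ≠ φ b' ∧ ∃ F : PointedCone ℝ (S → ℝ), IsProjEdge (titsCone cs) F ∧
    (φ b : ℙ ℝ (S → ℝ)) ∈ projSet (F : Set (S → ℝ)) ∧
    (φ b' : ℙ ℝ (S → ℝ)) ∈ projSet (F : Set (S → ℝ))) ↔
    (b ≠ b' ∧ ∃ p, (b : Set (ℙ ℝ (S → ℝ))) ∩ b' = {p})
  rw [hinj.ne_iff]
  refine and_congr_right fun hbb' => ?_
  have hne : ∀ c : ℝ, ρ b' ≠ c • ρ b := fun c hc => hbb' (Subtype.ext (by
    rw [← hρb b, ← hρb b']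
    exact ((ball_eq_ball_iff cs hirr hlor hlev (hρ b) (hρ b')).2 ⟨c, hc⟩).symm))
  rw [← hρb b, ← hρb b',
    exists_ball_inter_eq_singleton_iff cs hirr hlor hlev (hρ b) (hρ b') hne]
  exact exists_edge_iff cs hirr hlor hlev (hρ b) (hρ b') hne (hρ0 b) (hρ0 b')

end GeometricCoxeterMatrix

end

/-- For an irreducible Lorentzian Coxeter system of level `2`, the projective Tits cone is an
edge-tangent infinite polytope whose `1`-skeleton is the tangency graph of the Boyd–Maxwell
packing. -/
theorem mainTheorem6 {S : Type*} [Fintype S] [DecidableEq S] (G : GeometricCoxeterMatrix S)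
    {W : Type*} [Group W] (cs : CoxeterSystem G.M W)
    (hirr : G.IsIrreducible) (hlor : G.IsLorentzian) (hlev : G.IsOfLevel 2) :
    -- infinite polytope: infinitely many vertices, whose closed convex hull is everything
    ((projVertices (GeometricCoxeterMatrix.titsCone cs)).Infinite ∧
      GeometricCoxeterMatrix.titsCone cs = (PointedCone.hull ℝ
        {x | ∃ hx : x ≠ 0, x ∈ GeometricCoxeterMatrix.titsCone cs ∧ Projectivization.mk ℝ x hx ∈
          projVertices (GeometricCoxeterMatrix.titsCone cs)}).closure) ∧
    -- every edge is tangent to the projective light cone: its line meets the projective light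
    -- cone in exactly one point, and this point lies on the edge
    (∀ F : PointedCone ℝ (S → ℝ), IsProjEdge (GeometricCoxeterMatrix.titsCone cs) F →
      ∃ p ∈ projSet (F : Set (S → ℝ)),
        projSet (Submodule.span ℝ (F : Set (S → ℝ)) : Set (S → ℝ)) ∩ projSet G.lightCone = {p}) ∧
    -- the tangency graph is the 1-skeleton, the ball of a weight `ω` being the vertex spanned by `ω`
    (∃ f : tangencyGraph (GeometricCoxeterMatrix.boydMaxwell cs) ≃g
        projSkeleton (GeometricCoxeterMatrix.titsCone cs),
      ∀ (ω : S → ℝ) (hω : ω ∈ GeometricCoxeterMatrix.spaceLikeWeights cs) (h0 : ω ≠ 0),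
        (f ⟨G.ball ω, Set.mem_image_of_mem _ hω⟩ : ℙ ℝ (S → ℝ)) = Projectivization.mk ℝ ω h0) := by
  exact ⟨⟨GeometricCoxeterMatrix.projVertices_infinite cs hirr hlor hlev,
      GeometricCoxeterMatrix.titsCone_eq_closure_hull_vertices cs hirr hlor hlev⟩,
    fun F hF => GeometricCoxeterMatrix.edge_tangent cs hirr hlor hlev hF,
    GeometricCoxeterMatrix.exists_iso_tangencyGraph_projSkeleton cs hirr hlor hlev⟩
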